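/- Let $E$ be a Dedekind complete Riesz space with weak order unit $e$, and let $E^u$ be its universal completion, regarded as an $f$-algebra whose multiplicative unit is $e$. A conditional expectation on $E$ is a positive order continuous linear projection on $E$ that maps weak order units to weak order units and whose range $R(T)$ is a Dedekind complete Riesz subspace of $E$. Let $(T_i)_{i\in\mathbb N}$ be a filtration on $E$, that is, a sequence of conditional expectations on $E$ with $T_iT_j=T_jT_i=T_i$ for all $i<j$. Assume that $T_1$ is strictly positive ($T_1|f|=0$ implies $f=0$), that $T_1e=e$, and that $E=L^1(T_1)$ is the natural domain of $T_1$, i.e. $E=\mathrm{dom}(T_1)-\mathrm{dom}(T_1)$, where $\mathrm{dom}(T_1)$ consists of those $f\in E^u_+$ for which there is an upwards directed net $f_\alpha\uparrow f$ in $E_+$ with $(T_1f_\alpha)$ order bounded in $E^u$. For $p>1$ put $L^p(T_1)=\{x\in L^1(T_1): |x|^p\in L^1(T_1)\}$, where the power $|x|^p\in E^u$ is defined by functional calculus, $|x|^p=\int_{[0,\infty)}t^p\,dE_t$ with $(E_t)$ the spectral system of $|x|$ with respect to $e$. A sequence $(x_n)$ in $E$ converges in order to $x\in E$ if $|x_n-x|\le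 v_n$ for all $n$, for some sequence $v_n\downarrow 0$ in $E$; a series is order convergent if its partial sums converge in order. Let $p>2$ and $\gamma,k\in\mathbb R$, and let $(Y_n,T_n)_{n\in\mathbb N}$ be a martingale difference sequence in $L^p(T_1)$: $Y_n\in L^p(T_1)\cap R(T_n)$ for all $n\ge 1$ and $T_{n-1}Y_n=0$ for all $n\ge 2$. Let $(a_i)_{i\in\mathbb N}$ be a non-decreasing sequence of positive real numbers such that $\sum_{i=1}^\infty a_i^{-k}$ converges in $\mathbb R$, and suppose that $$\sum_{i=1}^\infty T_1\!\left(\frac{|Y_i|^p}{a_i^\gamma}\right)$$ is order convergent, where $p\ge\gamma+\left(\frac p2-1\right)k$. Then $$\frac1{a_n}\sum_{i=1}^nY_i\to 0\quad\text{in order as } n\to\infty.$$ -/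

import Mathlib

open scoped BigOperators

/-- The `f`-algebra law for a lattice-ordered commutative ring: multiplication by a positive
element preserves disjointness.  (Archimedean `f`-algebras are automatically commutative.) -/
class IsFAlgebra (U : Type*) [CommRing U] [Lattice U] : Prop where
  mul_inf_eq_zero : ∀ a b c : U, a ⊓ b = 0 → 0 ≤ c → (c * a) ⊓ b = 0

/-- Lateral completeness: every nonempty set of pairwise disjoint positive elements has a supremum. -/
def LaterallyComplete (U : Type*) [AddCommGroup U] [Lattice U] : Prop :=
  ∀ S : Set U, S.Nonempty → (∀ x ∈ S, 0 ≤ x) → S.Pairwise (fun x y => x ⊓ y = 0) → ∃ s, IsLUB S s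

/-- `ι : E → U` exhibits the Dedekind complete Riesz space `U` as the universal completion of the
Riesz space `E`: `U` is laterally complete, and `ι` is an injective linear lattice homomorphism
onto an order dense Riesz subspace of `U`. -/
structure IsUniversalCompletion {E U : Type*} [AddCommGroup E] [Lattice E] [Module ℝ E]
    [AddCommGroup U] [ConditionallyCompleteLattice U] [Module ℝ U] (ι : E →ₗ[ℝ] U) : Prop where
  laterallyComplete : LaterallyComplete U
  injective : Function.Injective ι
  map_sup : ∀ x y : E, ι (x ⊔ y) = ι x ⊔ ι y
  orderDense : ∀ u : U, 0 < u → ∃ x : E, 0 < ι x ∧ ι x ≤ u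

section Riesz

variable {E : Type*} [AddCommGroup E] [Lattice E]

/-- `e` is a weak order unit. -/
def IsWeakOrderUnit (e : E) : Prop :=
  0 ≤ e ∧ ∀ x : E, e ⊓ |x| = 0 → x = 0

/-- Order convergence of sequences: `|xₙ - x| ≤ vₙ` for some sequence `vₙ ↓ 0` in `E`. -/
def OrderTendsto (x : ℕ → E) (l : E) : Prop :=
  ∃ v : ℕ → E, Antitone v ∧ IsGLB (Set.range v) 0 ∧ ∀ n, |x n - l| ≤ v n

/-- The series `∑ xᵢ` is order convergent. -/
def OrderSummable (x : ℕ → E) : Prop :=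
  ∃ s : E, OrderTendsto (fun n => ∑ i ∈ Finset.range n, x i) s

variable [Module ℝ E]

/-- `T` is a conditional expectation on the Riesz space `E`: a positive order continuous linear
projection which maps weak order units to weak order units and whose range is a Dedekind complete
Riesz subspace of `E`. -/
structure IsConditionalExpectation (T : E →ₗ[ℝ] E) : Prop where
  nonneg : ∀ x, 0 ≤ x → 0 ≤ T x
  orderContinuous : ∀ D : Set E, D.Nonempty → DirectedOn (· ≥ ·) D → IsGLB D 0 →
    IsGLB (T '' D) 0
  projection : ∀ x, T (T x) = T x
  map_weakOrderUnit : ∀ e, IsWeakOrderUnit e → IsWeakOrderUnit (T e)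
  range_sup : ∀ x ∈ Set.range T, ∀ y ∈ Set.range T, x ⊔ y ∈ Set.range T
  range_complete : ∀ A : Set (Set.range T), A.Nonempty → BddAbove A → ∃ s, IsLUB A s

/-- `T` is strictly positive: `T|f| = 0` implies `f = 0`. -/
def StrictlyPositiveOperator (T : E →ₗ[ℝ] E) : Prop :=
  ∀ f, T |f| = 0 → f = 0

/-- A filtration: conditional expectations with `Tᵢ Tⱼ = Tⱼ Tᵢ = Tᵢ` for `i < j`. -/
structure IsRieszFiltration (T : ℕ → E →ₗ[ℝ] E) : Prop where
  condExp : ∀ i, IsConditionalExpectation (T i)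
  comp_left : ∀ i j, i < j → ∀ x, T i (T j x) = T i x
  comp_right : ∀ i j, i < j → ∀ x, T j (T i x) = T i x

/-- `(Y, T)` is a martingale difference sequence (indices start at `0`). -/
structure IsMartingaleDifference (Y : ℕ → E) (T : ℕ → E →ₗ[ℝ] E) : Prop where
  filtration : IsRieszFiltration T
  adapted : ∀ i, Y i ∈ Set.range (T i)
  diff : ∀ i, T i (Y (i + 1)) = 0

end Riesz

/-- The cone `dom(T)` in `U`: the positive `f ∈ U` that are the supremum of an upwards directed
family `D` of positive elements of `E` for which `T(D)` is order bounded in `U`. -/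
def natDomCone {E U : Type*} [AddCommGroup E] [Lattice E] [Module ℝ E]
    [AddCommGroup U] [Lattice U] [Module ℝ U] (ι : E →ₗ[ℝ] U) (T : E →ₗ[ℝ] E) : Set U :=
  {f | 0 ≤ f ∧ ∃ D : Set E, D.Nonempty ∧ DirectedOn (· ≤ ·) D ∧ (∀ g ∈ D, 0 ≤ g) ∧
    IsLUB (ι '' D) f ∧ BddAbove ((fun g => ι (T g)) '' D)}

/-- `E` (embedded in `U` by `ι`) is the natural domain `L¹(T) = dom(T) - dom(T)` of `T`. -/
def IsNaturalDomain {E U : Type*} [AddCommGroup E] [Lattice E] [Module ℝ E]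
    [AddCommGroup U] [Lattice U] [Module ℝ U] (ι : E →ₗ[ℝ] U) (T : E →ₗ[ℝ] E) : Prop :=
  Set.range ι = {f | ∃ g ∈ natDomCone ι T, ∃ h ∈ natDomCone ι T, f = g - h}

noncomputable section FunctionalCalculus

variable {U : Type*} [CommRing U] [ConditionallyCompleteLattice U] [Algebra ℝ U]

/-- With `e = 1`: the component `P e = ⨆ₙ (e ⊓ n (x - t e)⁺)` of `e` in the band generated by
`(x - t e)⁺`; it plays the role of the indicator of `{x > t}`.  The spectral system of `x` is
`t ↦ e - upperComponent x t`. -/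
def upperComponent (x : U) (t : ℝ) : U :=
  ⨆ n : ℕ, (1 : U) ⊓ n • ((x - t • (1 : U)) ⊔ 0)

/-- The functional calculus `f(x) = ∫_{[0,∞)} f(t) dEₜ` for `x ≥ 0` in `U` and `f` nonnegative and
nondecreasing on `[0,∞)`, where `Eₜ = e - upperComponent x t` is the spectral system of `x`: the
supremum of the lower Stieltjes sums `∑ f(tᵢ) (E_{tᵢ₊₁} - E_{tᵢ})` over all finite partitions
`0 ≤ t₀ ≤ t₁ ≤ … ≤ t_N`. -/
def spectralIntegral (f : ℝ → ℝ) (x : U) : U :=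
  sSup {s | ∃ (N : ℕ) (t : ℕ → ℝ), 0 ≤ t 0 ∧ Monotone t ∧
    s = ∑ i ∈ Finset.range N, f (t i) • (upperComponent x (t i) - upperComponent x (t (i + 1)))}

/-- The power `x ^ p` of a positive element `x` of `U`, for real `p > 0`. -/
def rieszPow (x : U) (p : ℝ) : U :=
  spectralIntegral (fun t => t ^ p) x

variable {E : Type*} [AddCommGroup E] [Lattice E] [Module ℝ E]

/-- With `E = L¹(T)` embedded in `U` by `ι`: the space `Lᵖ(T) = {x ∈ L¹(T) : |x|ᵖ ∈ L¹(T)}`. -/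
def rieszLp (ι : E →ₗ[ℝ] U) (p : ℝ) : Set E :=
  {x | rieszPow |ι x| p ∈ Set.range ι}

/-- `|x|ᵖ` as an element of `E`, for `x` in `rieszLp ι p` (where `ι` is injective). -/
def absPow (ι : E →ₗ[ℝ] U) (p : ℝ) (x : E) : E :=
  Function.invFun ι (rieszPow |ι x| p)

end FunctionalCalculus

/-! Kronecker's lemma reduces the claim to showing that the martingale of partial sums of `X i = Y i
/ a i` is order Cauchy; `a` tends to infinity because the terms `1 / a i ^ k` tend to zero.

The scalar inequality `t ^ 2 / a ^ 2 ≤ t ^ p / a ^ γ + C / a ^ k` (`sq_div_le_rpow_add`) passes to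
the functional calculus by comparison on small spectral pieces (`smul_mul_self_le_rieszPow`). Hence
the squares of the `X i` lie in `E` and the sums of their images under `T 0` are bounded: the
martingale is bounded in L².

For such a martingale, a pathwise Doob inequality (`runningMax_pathwise`) bounds the running maximum
`m` of the increments after time `n` by a square, up to a sum of terms `X i * m i`. The operator `T
0` annihilates that sum by the averaging property (`map_mul_eq_zero`), itself a consequence of
Jensen's inequality for squares. This gives `ε T m ≤ ε² e + (tail of ∑ T X²)`. Monotone convergence
in the natural domain (`bddAbove_of_map_le`) makes the supremum of these maxima exist in `E`; as `n`
grows and `ε` shrinks, strict positivity of `T 0` forces the infimum of these suprema to be zero. -/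

set_option linter.unusedSectionVars false

/-! ### Dedekind complete groups: the Archimedean property and disjointness -/

section OrderedGroup

variable {G : Type*} [AddCommGroup G] [ConditionallyCompleteLattice G] [IsOrderedAddMonoid G]

/-- Dedekind completeness implies the Archimedean property: the supremum `s` of the multiples of `x`
satisfies `s ≤ s - x`. -/
theorem nonpos_of_forall_nsmul_le {x y : G} (h : ∀ n : ℕ, n • x ≤ y) : x ≤ 0 := by
  have hb : BddAbove (Set.range fun n : ℕ => n • x) := ⟨y, by rintro _ ⟨n, rfl⟩; exact h n⟩
  have hs : (⨆ n : ℕ, n • x) ≤ (⨆ n : ℕ, n • x) - x := ciSup_le fun n => by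
    rw [le_sub_iff_add_le, ← succ_nsmul]
    exact le_ciSup hb (n + 1)
  simpa using hs

theorem nonpos_of_forall_le_smul [Module ℝ G] [IsOrderedModule ℝ G] {x y : G} (hy : 0 ≤ y)
    (h : ∀ ε : ℝ, 0 < ε → x ≤ ε • y) : x ≤ 0 := by
  refine nonpos_of_forall_nsmul_le (y := y) fun n => ?_
  rcases Nat.eq_zero_or_pos n with rfl | hn
  · simpa using hy
  have hn' : (0 : ℝ) < n := by exact_mod_cast hn
  have := smul_le_smul_of_nonneg_left (h (1 / n) (by positivity)) hn'.le
  rw [smul_smul, mul_one_div_cancel hn'.ne', one_smul] at this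
  rwa [← Nat.cast_smul_eq_nsmul ℝ]

theorem add_eq_sup_of_inf_eq_zero {G : Type*} [AddCommGroup G] [Lattice G] [IsOrderedAddMonoid G]
    {a b : G} (h : a ⊓ b = 0) : a + b = a ⊔ b := by
  rw [← inf_add_sup a b, h, zero_add]

/-- With `c = b ⊓ s` disjoint from each `x` in `S`, the sum `c + x` equals `c ⊔ x`, which is at most
`s`. So `s - c` is again an upper bound of `S`. -/
theorem inf_eq_zero_of_isLUB {S : Set G} {s b : G} (hb : 0 ≤ b) (hs0 : 0 ≤ s) (hs : IsLUB S s)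
    (hS : ∀ x ∈ S, 0 ≤ x) (h : ∀ x ∈ S, b ⊓ x = 0) : b ⊓ s = 0 := by
  have h0 : 0 ≤ b ⊓ s := le_inf hb hs0
  refine le_antisymm ?_ h0
  have : s ≤ s - b ⊓ s := hs.2 fun x hx => by
    have hd : (b ⊓ s) ⊓ x = 0 :=
      le_antisymm ((inf_le_inf_right x inf_le_left).trans (h x hx).le) (le_inf h0 (hS x hx))
    rw [le_sub_iff_add_le, add_comm, add_eq_sup_of_inf_eq_zero hd]
    exact sup_le inf_le_right (hs.1 hx)
  simpa using this

end OrderedGroup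

/-! ### Products and squares in an `f`-algebra -/

section FAlgebra

variable {U : Type*} [CommRing U] [ConditionallyCompleteLattice U] [IsOrderedRing U]
  [IsFAlgebra U]

/-- Two applications of the `f`-algebra law make the product disjoint from itself. -/
theorem mul_eq_zero_of_inf_eq_zero {a b : U} (h : a ⊓ b = 0) : a * b = 0 := by
  have ha : 0 ≤ a := h ▸ inf_le_left
  have hb : 0 ≤ b := h ▸ inf_le_right
  have h1 := IsFAlgebra.mul_inf_eq_zero a b b h hb
  rw [inf_comm] at h1
  have h2 := IsFAlgebra.mul_inf_eq_zero b (b * a) a h1 ha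
  rwa [mul_comm b a, inf_idem] at h2

theorem posPart_mul_negPart (x : U) : x⁺ * x⁻ = 0 :=
  mul_eq_zero_of_inf_eq_zero (posPart_inf_negPart_eq_zero x)

theorem abs_mul_abs_eq (x : U) : |x| * |x| = x * x := by
  have h := posPart_mul_negPart x
  have h1 : x = x⁺ - x⁻ := (posPart_sub_negPart x).symm
  have h2 : x * x = (x⁺ - x⁻) * (x⁺ - x⁻) := by rw [← h1]
  rw [← posPart_add_negPart x, h2]
  linear_combination 4 * h

theorem mul_self_nonneg_of_fAlgebra (x : U) : 0 ≤ x * x := by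
  rw [← abs_mul_abs_eq]
  exact mul_nonneg (abs_nonneg x) (abs_nonneg x)

theorem mul_self_le_of_abs_le {x y : U} (h : |x| ≤ |y|) : x * x ≤ y * y := by
  rw [← abs_mul_abs_eq x, ← abs_mul_abs_eq y]
  exact mul_le_mul h h (abs_nonneg x) (abs_nonneg y)

end FAlgebra

/-! ### The spectral system as a calculus of indicators -/

section SpectralSystem

variable {U : Type*} [CommRing U] [ConditionallyCompleteLattice U] [IsOrderedRing U]
  [Algebra ℝ U]

theorem isLUB_upperComponent (x : U) (t : ℝ) :
    IsLUB (Set.range fun n : ℕ => (1 : U) ⊓ n • ((x - t • (1 : U)) ⊔ 0)) (upperComponent x t) :=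
  isLUB_ciSup ⟨1, by rintro _ ⟨n, rfl⟩; exact inf_le_left⟩

theorem upperComponent_le_one (x : U) (t : ℝ) : upperComponent x t ≤ 1 :=
  (isLUB_upperComponent x t).2 (by rintro _ ⟨n, rfl⟩; exact inf_le_left)

theorem upperComponent_nonneg (x : U) (t : ℝ) : 0 ≤ upperComponent x t :=
  (isLUB_upperComponent x t).1 ⟨0, by simp⟩

theorem upperComponent_mono_left {x y : U} (h : x ≤ y) (t : ℝ) :
    upperComponent x t ≤ upperComponent y t := by
  refine (isLUB_upperComponent x t).2 ?_
  rintro _ ⟨n, rfl⟩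
  refine le_trans ?_ ((isLUB_upperComponent y t).1 ⟨n, rfl⟩)
  exact inf_le_inf_left _ (nsmul_le_nsmul_right (sup_le_sup_right (sub_le_sub_right h _) _) n)

/-- Adding the infimum `c` to the `n`-th approximant of the component stays below the next
approximant, so the supremum absorbs `c`. -/
theorem one_sub_upperComponent_inf (x : U) (t : ℝ) :
    (1 - upperComponent x t) ⊓ (x - t • (1 : U))⁺ = 0 := by
  rw [posPart_def]
  set a := (x - t • (1 : U)) ⊔ 0
  set c := (1 - upperComponent x t) ⊓ a
  have ha : 0 ≤ a := le_sup_right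
  refine le_antisymm ?_ (le_inf (sub_nonneg.2 (upperComponent_le_one x t)) ha)
  have hL := isLUB_upperComponent x t
  have : upperComponent x t ≤ upperComponent x t - c := hL.2 <| by
    rintro _ ⟨n, rfl⟩
    rw [le_sub_iff_add_le]
    refine le_trans (le_inf ?_ ?_) (hL.1 ⟨n + 1, rfl⟩)
    · have h1 : (1 : U) ⊓ n • a ≤ upperComponent x t := hL.1 ⟨n, rfl⟩
      have h2 : c ≤ 1 - upperComponent x t := inf_le_left
      calc _ ≤ upperComponent x t + (1 - upperComponent x t) := add_le_add h1 h2
        _ = 1 := by abel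
    · rw [succ_nsmul]
      exact add_le_add inf_le_right inf_le_right
  simpa using this

variable [IsFAlgebra U]

theorem inf_upperComponent_eq_zero {x b : U} {t : ℝ} (h : b ⊓ (x - t • (1 : U))⁺ = 0) :
    b ⊓ upperComponent x t = 0 := by
  have hb : 0 ≤ b := h ▸ inf_le_left
  have ha : (0 : U) ≤ (x - t • (1 : U))⁺ := posPart_nonneg _
  refine inf_eq_zero_of_isLUB hb (upperComponent_nonneg x t) (isLUB_upperComponent x t) ?_ ?_
  · rintro _ ⟨n, rfl⟩
    exact le_inf zero_le_one (nsmul_nonneg ha n)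
  · rintro _ ⟨n, rfl⟩
    have h1 := IsFAlgebra.mul_inf_eq_zero _ _ (n : U) (inf_comm b _ ▸ h) (Nat.cast_nonneg n)
    rw [← nsmul_eq_mul, inf_comm] at h1
    refine le_antisymm (le_trans (inf_le_inf_left b inf_le_right) h1.le) ?_
    exact le_inf hb (le_inf zero_le_one (nsmul_nonneg ha n))

theorem one_sub_upperComponent_inf_self (x : U) (t : ℝ) :
    (1 - upperComponent x t) ⊓ upperComponent x t = 0 :=
  inf_upperComponent_eq_zero (one_sub_upperComponent_inf x t)

theorem upperComponent_mul_self (x : U) (t : ℝ) :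
    upperComponent x t * upperComponent x t = upperComponent x t := by
  have := mul_eq_zero_of_inf_eq_zero (one_sub_upperComponent_inf_self x t)
  linear_combination -this

/-- The component fixes the positive part of `x - t` and annihilates its negative part. All
Chebyshev-type bounds below come from this identity. -/
theorem sub_mul_upperComponent (x : U) (t : ℝ) :
    (x - t • (1 : U)) * upperComponent x t = (x - t • (1 : U))⁺ := by
  have h1 := mul_eq_zero_of_inf_eq_zero (one_sub_upperComponent_inf x t)
  have h2 : (x - t • (1 : U))⁻ * upperComponent x t = 0 := mul_eq_zero_of_inf_eq_zero <|
    inf_upperComponent_eq_zero (by rw [inf_comm]; exact posPart_inf_negPart_eq_zero _)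
  nth_rw 1 [← posPart_sub_negPart (x - t • (1 : U))]
  linear_combination -h1 - h2

theorem smul_upperComponent_le (x : U) (t : ℝ) :
    t • upperComponent x t ≤ x * upperComponent x t := by
  rw [← sub_nonneg]
  convert posPart_nonneg (x - t • (1 : U)) using 1
  rw [← sub_mul_upperComponent, sub_mul, smul_mul_assoc, one_mul]

theorem mul_one_sub_upperComponent_le (x : U) (t : ℝ) :
    x * (1 - upperComponent x t) ≤ t • (1 - upperComponent x t) := by
  rw [← sub_nonneg]
  convert negPart_nonneg (x - t • (1 : U)) using 1
  have := sub_mul_upperComponent x t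
  rw [sub_mul, smul_mul_assoc, one_mul] at this
  have h := posPart_sub_negPart (x - t • (1 : U))
  rw [← this] at h
  rw [smul_sub]
  linear_combination h

variable [IsOrderedModule ℝ U]

theorem upperComponent_anti (x : U) : Antitone (upperComponent x) := by
  intro s t hst
  refine (isLUB_upperComponent x t).2 ?_
  rintro _ ⟨n, rfl⟩
  refine le_trans ?_ ((isLUB_upperComponent x s).1 ⟨n, rfl⟩)
  refine inf_le_inf_left _ (nsmul_le_nsmul_right (sup_le_sup_right (sub_le_sub_left ?_ _) _) n)
  exact smul_le_smul_of_nonneg_right hst zero_le_one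

theorem upperComponent_mul_of_le (x : U) {s t : ℝ} (h : s ≤ t) :
    upperComponent x s * upperComponent x t = upperComponent x t := by
  have h1 : (1 - upperComponent x s) ⊓ upperComponent x t = 0 := by
    refine le_antisymm ?_ (le_inf (sub_nonneg.2 (upperComponent_le_one x s))
      (upperComponent_nonneg x t))
    rw [← one_sub_upperComponent_inf_self x s]
    exact inf_le_inf_left _ (upperComponent_anti x h)
  have := mul_eq_zero_of_inf_eq_zero h1
  linear_combination -this

/-- The component of the unit on which `s < x ≤ t`. -/
noncomputable def spectralStep (x : U) (s t : ℝ) : U := upperComponent x s - upperComponent x t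

theorem spectralStep_nonneg (x : U) {s t : ℝ} (h : s ≤ t) : 0 ≤ spectralStep x s t :=
  sub_nonneg.2 (upperComponent_anti x h)

theorem spectralStep_le_one (x : U) (s t : ℝ) : spectralStep x s t ≤ 1 :=
  (sub_le_self _ (upperComponent_nonneg x t)).trans (upperComponent_le_one x s)

theorem spectralStep_eq_mul (x : U) {s t : ℝ} (h : s ≤ t) :
    spectralStep x s t = upperComponent x s * (1 - upperComponent x t) := by
  rw [spectralStep, mul_sub, upperComponent_mul_of_le x h, mul_one]

theorem spectralStep_mul_self (x : U) {s t : ℝ} (h : s ≤ t) :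
    spectralStep x s t * spectralStep x s t = spectralStep x s t := by
  have h1 := upperComponent_mul_self x s
  have h2 := upperComponent_mul_self x t
  have h3 := upperComponent_mul_of_le x h
  rw [spectralStep]
  linear_combination h1 + h2 - 2 * h3

theorem smul_spectralStep_le (x : U) {s t : ℝ} (h : s ≤ t) :
    s • spectralStep x s t ≤ x * spectralStep x s t := by
  rw [spectralStep_eq_mul x h, ← mul_assoc, ← smul_mul_assoc]
  exact mul_le_mul_of_nonneg_right (smul_upperComponent_le x s)
    (sub_nonneg.2 (upperComponent_le_one x t))

theorem mul_spectralStep_le (x : U) {s t : ℝ} (h : s ≤ t) :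
    x * spectralStep x s t ≤ t • spectralStep x s t := by
  rw [spectralStep_eq_mul x h, mul_left_comm, ← mul_smul_comm]
  exact mul_le_mul_of_nonneg_left (mul_one_sub_upperComponent_le x t)
    (upperComponent_nonneg x s)

theorem mul_upperComponent_zero (x : U) : x * upperComponent x 0 = x⁺ := by
  simpa using sub_mul_upperComponent x 0

/-- An inequality may be checked on small pieces of the spectrum of `y`. -/
theorem nonpos_of_forall_mul_spectralStep_le (y r : U)
    (h : ∀ (N : ℕ) (ε : ℝ), 0 < ε → ∃ m : ℕ, 0 < m ∧ ∀ s : ℝ, -N ≤ s → s ≤ N →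
      r * spectralStep y s (s + 1 / m) ≤ ε • spectralStep y s (s + 1 / m)) : r ≤ 0 := by
  have key : ∀ N : ℕ, r⁺ * spectralStep y (-N) N ≤ 0 := by
    intro N
    refine nonpos_of_forall_le_smul (y := (1 : U)) zero_le_one fun ε hε => ?_
    obtain ⟨m, hm, hs⟩ := h N ε hε
    have hm' : (0 : ℝ) < m := by exact_mod_cast hm
    have hpos : ∀ s : ℝ, -N ≤ s → s ≤ N →
        r⁺ * spectralStep y s (s + 1 / m) ≤ ε • spectralStep y s (s + 1 / m) := by
      intro s h1 h2
      have hq := spectralStep_nonneg y (show s ≤ s + 1 / m by simp [hm'.le])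
      -- Multiplying by the indicator of `{r > 0}` turns `r` into `r⁺`.
      have h3 := mul_le_mul_of_nonneg_right (hs s h1 h2) (upperComponent_nonneg r 0)
      rw [mul_right_comm, mul_upperComponent_zero] at h3
      refine h3.trans ?_
      exact mul_le_of_le_one_right (smul_nonneg hε.le hq) (upperComponent_le_one r 0)
    have hsum : ∀ j : ℕ, j ≤ 2 * N * m →
        r⁺ * spectralStep y (-N) (-N + j / m) ≤ ε • spectralStep y (-N) (-N + j / m) := by
      intro j
      induction j with
      | zero => intro _; simp [spectralStep]
      | succ j ih =>
        intro hj
        have hj' : (j : ℝ) ≤ 2 * N * m := by exact_mod_cast (Nat.le_of_succ_le hj)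
        have e : (-N + ((j + 1 : ℕ) : ℝ) / m) = (-N + j / m) + 1 / m := by push_cast; ring
        have h2 := hpos (-N + j / m) (by simp; positivity) (by
          have : (j : ℝ) / m ≤ 2 * N := by rw [div_le_iff₀ hm']; exact hj'
          linarith)
        have hsplit : spectralStep y (-N) (-N + ((j + 1 : ℕ) : ℝ) / m) =
            spectralStep y (-N) (-N + j / m) +
              spectralStep y (-N + j / m) (-N + j / m + 1 / m) := by
          rw [e]; simp only [spectralStep]; abel
        rw [hsplit, mul_add, smul_add]
        exact add_le_add (ih (Nat.le_of_succ_le hj)) h2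
    have := hsum (2 * N * m) le_rfl
    have e : (-N + ((2 * N * m : ℕ) : ℝ) / m) = N := by
      push_cast; field_simp; ring
    rw [e] at this
    exact this.trans (smul_le_smul_of_nonneg_left (spectralStep_le_one y _ _) hε.le)
  suffices hr : r⁺ ≤ 0 from (le_posPart r).trans hr
  have hr0 := posPart_nonneg r
  -- By `key`, `r⁺` lives where `y > N` or `y ≤ -N`. Chebyshev's inequality bounds `N` times each of
  -- these two components by `|y|`, and the Archimedean property concludes.
  refine nonpos_of_forall_nsmul_le (y := (|y| + |y|) * r⁺) fun N => ?_
  have h1 : (N : ℝ) • upperComponent y N ≤ |y| :=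
    (smul_upperComponent_le y N).trans <|
      (mul_le_mul_of_nonneg_right (le_abs_self y) (upperComponent_nonneg y _)).trans
        (mul_le_of_le_one_right (abs_nonneg y) (upperComponent_le_one y _))
  have h2 : (N : ℝ) • (1 - upperComponent y (-N)) ≤ |y| := by
    have h3 := mul_one_sub_upperComponent_le y (-N)
    rw [neg_smul, le_neg, ← neg_mul] at h3
    have h0 := sub_nonneg.2 (upperComponent_le_one y (-N))
    exact h3.trans <|
      (mul_le_mul_of_nonneg_right (neg_le_abs y) h0).trans
        (mul_le_of_le_one_right (abs_nonneg y) (sub_le_self _ (upperComponent_nonneg y _)))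
  have h3 : r⁺ ≤ (1 - upperComponent y (-N) + upperComponent y N) * r⁺ := by
    rw [← sub_nonneg, ← neg_nonpos]
    convert key N using 1
    rw [spectralStep]; ring
  rw [← Nat.cast_smul_eq_nsmul ℝ]
  refine (smul_le_smul_of_nonneg_left h3 (Nat.cast_nonneg N)).trans ?_
  rw [← smul_mul_assoc, smul_add]
  exact mul_le_mul_of_nonneg_right (add_le_add h2 h1) hr0

end SpectralSystem

/-! ### Transfer of scalar inequalities to squares and powers -/

section SpectralInequalities

variable {U : Type*} [CommRing U] [ConditionallyCompleteLattice U] [IsOrderedRing U]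
  [Algebra ℝ U] [IsFAlgebra U] [IsOrderedModule ℝ U]

theorem mul_self_mul_spectralStep_le {x : U} {b s t : ℝ} (hst : s ≤ t)
    (h0 : 0 ≤ x * spectralStep x s t) (h : x * spectralStep x s t ≤ b • spectralStep x s t) :
    x * x * spectralStep x s t ≤ b ^ 2 • spectralStep x s t := by
  have hq := spectralStep_mul_self x hst
  have h1 := mul_le_mul h h h0 (h0.trans h)
  rw [smul_mul_smul_comm, hq] at h1
  convert h1 using 1
  · linear_combination (-(x * x)) * hq
  · rw [sq]

/-- A square is the supremum of its scalar tangents. -/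
theorem mul_self_le_of_forall_tangent_le (y z : U)
    (h : ∀ t : ℝ, (2 * t) • y - t ^ 2 • (1 : U) ≤ z) : y * y ≤ z := by
  rw [← sub_nonpos]
  refine nonpos_of_forall_mul_spectralStep_le y _ fun N ε hε => ?_
  obtain ⟨n, hn⟩ := exists_nat_one_div_lt hε
  refine ⟨n + 1, n.succ_pos, fun s _ _ => ?_⟩
  set d : ℝ := 1 / ((n + 1 : ℕ) : ℝ) with hd
  have hd0 : 0 < d := by positivity
  have hd1 : d ≤ 1 := by
    rw [hd, div_le_one (by positivity)]; exact_mod_cast Nat.succ_le_succ n.zero_le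
  have hdε : d ≤ ε := by rw [hd]; push_cast; exact hn.le
  have hst : s ≤ s + d := by linarith
  have hq0 := spectralStep_nonneg y hst
  have hq := spectralStep_mul_self y hst
  set q := spectralStep y s (s + d)
  have h1 : 0 ≤ (y - s • (1 : U)) * q := by
    rw [sub_mul, smul_mul_assoc, one_mul, sub_nonneg]
    exact smul_spectralStep_le y hst
  have h2 : (y - s • (1 : U)) * q ≤ d • q := by
    rw [sub_mul, smul_mul_assoc, one_mul, sub_le_iff_le_add, ← add_smul, add_comm d]
    exact mul_spectralStep_le y hst
  have h3 := mul_le_mul h2 h2 h1 (h1.trans h2)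
  rw [smul_mul_smul_comm, hq] at h3
  -- The tangent at `s` misses the square by exactly `(y - s)²`, which is at most `d²` on the piece
  -- `{s < y ≤ s + d}`.
  have h4 : (y * y - z) * q ≤ (y - s • (1 : U)) * (y - s • (1 : U)) * q := by
    refine mul_le_mul_of_nonneg_right ?_ hq0
    have := h s
    rw [sub_le_iff_le_add] at this ⊢
    have e : (y - s • (1 : U)) * (y - s • (1 : U)) = y * y - ((2 * s) • y - s ^ 2 • (1 : U)) := by
      simp only [Algebra.smul_def, map_mul, map_pow, map_ofNat]; ring
    rw [e, sub_add, le_sub_self_iff, sub_nonpos, sub_le_iff_le_add]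
    exact this
  refine h4.trans ((le_of_eq ?_).trans (h3.trans ?_))
  · linear_combination (-((y - s • (1 : U)) * (y - s • (1 : U)))) * hq
  · exact smul_le_smul_of_nonneg_right (by nlinarith) hq0

theorem pow_smul_spectralStep_le {y : U} (hy : 0 ≤ y) {s t : ℝ} (hs : 0 ≤ s) (hst : s ≤ t)
    (m : ℕ) : s ^ m • spectralStep y s t ≤ y ^ m * spectralStep y s t := by
  induction m with
  | zero => simp
  | succ m ih =>
    calc s ^ (m + 1) • spectralStep y s t = s • (s ^ m • spectralStep y s t) := by
          rw [smul_smul, pow_succ']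
      _ ≤ s • (y ^ m * spectralStep y s t) := smul_le_smul_of_nonneg_left ih hs
      _ = y ^ m * (s • spectralStep y s t) := by rw [mul_smul_comm]
      _ ≤ y ^ m * (y * spectralStep y s t) :=
          mul_le_mul_of_nonneg_left (smul_spectralStep_le y hst) (pow_nonneg hy m)
      _ = y ^ (m + 1) * spectralStep y s t := by ring

/-- The `sSup` defining the power is meaningful only if the lower sums are bounded. Since `t ^ p ≤ 1
+ t ^ ⌈p⌉₊` for `t ≥ 0`, the ring element `1 + y ^ ⌈p⌉₊` bounds them all. -/
theorem isLUB_rieszPow {y : U} (hy : 0 ≤ y) {p : ℝ} (hp : 0 < p) :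
    IsLUB {s | ∃ (N : ℕ) (t : ℕ → ℝ), 0 ≤ t 0 ∧ Monotone t ∧
      s = ∑ i ∈ Finset.range N,
        (t i) ^ p • (upperComponent y (t i) - upperComponent y (t (i + 1)))} (rieszPow y p) := by
  refine isLUB_csSup ⟨0, 0, fun _ => 0, le_rfl, monotone_const, by simp⟩
    ⟨1 + y ^ ⌈p⌉₊, ?_⟩
  rintro _ ⟨N, t, ht0, ht, rfl⟩
  have hz : 0 ≤ 1 + y ^ ⌈p⌉₊ := add_nonneg zero_le_one (pow_nonneg hy _)
  have hterm : ∀ i, (t i) ^ p • (upperComponent y (t i) - upperComponent y (t (i + 1))) ≤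
      (1 + y ^ ⌈p⌉₊) * (upperComponent y (t i) - upperComponent y (t (i + 1))) := by
    intro i
    have hti : 0 ≤ t i := ht0.trans (ht i.zero_le)
    have hii := ht i.le_succ
    have hq0 := spectralStep_nonneg y hii
    have h1 : (t i) ^ p ≤ 1 + (t i) ^ ⌈p⌉₊ := by
      rcases le_total (t i) 1 with h | h
      · have := Real.rpow_le_one hti h hp.le
        have : 0 ≤ (t i) ^ ⌈p⌉₊ := by positivity
        linarith
      · have := Real.rpow_le_rpow_of_exponent_le h (Nat.le_ceil p)
        rw [Real.rpow_natCast] at this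
        linarith
    have h2 := pow_smul_spectralStep_le hy hti hii ⌈p⌉₊
    refine (smul_le_smul_of_nonneg_right h1 hq0).trans ?_
    rw [add_smul, one_smul, add_mul, one_mul]
    exact add_le_add_right h2 _
  refine (Finset.sum_le_sum fun i _ => hterm i).trans ?_
  rw [← Finset.mul_sum, Finset.sum_range_sub']
  exact mul_le_of_le_one_right hz (spectralStep_le_one y _ _)

theorem rieszPow_nonneg {y : U} (hy : 0 ≤ y) {p : ℝ} (hp : 0 < p) : 0 ≤ rieszPow y p :=
  (isLUB_rieszPow hy hp).1 ⟨0, fun _ => 0, le_rfl, monotone_const, by simp⟩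

/-- The left side is the lower sum of a one-interval partition; multiplying by the idempotent step
localizes the bound. -/
theorem rpow_smul_spectralStep_le {y : U} (hy : 0 ≤ y) {p : ℝ} (hp : 0 < p) {s t : ℝ}
    (hs : 0 ≤ s) (hst : s ≤ t) :
    s ^ p • spectralStep y s t ≤ rieszPow y p * spectralStep y s t := by
  have h1 : s ^ p • spectralStep y s t ≤ rieszPow y p := by
    refine (isLUB_rieszPow hy hp).1 ⟨1, fun i => if i = 0 then s else t, by simpa using hs, ?_, ?_⟩
    · intro i j hij
      by_cases hi : i = 0
      · by_cases hj : j = 0 <;> simp [hi, hj, hst]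
      · have hj : j ≠ 0 := by omega
        simp [hi, hj]
    · simp [spectralStep]
  have h2 := mul_le_mul_of_nonneg_right h1 (spectralStep_nonneg y hst)
  rwa [smul_mul_assoc, spectralStep_mul_self y hst] at h2

/-- Scalar bounds of squares by powers pass to the functional calculus. -/
theorem smul_mul_self_le_rieszPow {y : U} (hy : 0 ≤ y) {p : ℝ} (hp : 0 < p) {α β c : ℝ}
    (hα : 0 ≤ α) (hβ : 0 ≤ β) (hc : 0 ≤ c) (h : ∀ t : ℝ, 0 ≤ t → α * t ^ 2 ≤ c * t ^ p + β) :
    α • (y * y) ≤ c • rieszPow y p + β • (1 : U) := by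
  rw [← sub_nonpos]
  refine nonpos_of_forall_mul_spectralStep_le y _ fun N ε hε => ?_
  -- On a piece of length `d ≤ 1` starting in `[0, N]`, squares vary by at most `(2N + 1) d`; the
  -- mesh makes `α` times this at most `ε`.
  obtain ⟨n, hn⟩ := exists_nat_gt (α * (2 * N + 1) / ε)
  refine ⟨n + 1, n.succ_pos, fun s _ hsN => ?_⟩
  set d : ℝ := 1 / ((n + 1 : ℕ) : ℝ) with hd
  have hd0 : 0 < d := by positivity
  have hd1 : d ≤ 1 := by
    rw [hd, div_le_one (by positivity)]; exact_mod_cast Nat.succ_le_succ n.zero_le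
  have hdε : α * (2 * N + 1) * d ≤ ε := by
    rw [div_lt_iff₀ hε] at hn
    rw [hd, mul_one_div, div_le_iff₀ (by positivity)]
    push_cast
    linarith
  have hst : s ≤ s + d := by linarith
  have hq0 := spectralStep_nonneg y hst
  have hyq : 0 ≤ y * spectralStep y s (s + d) := mul_nonneg hy hq0
  have hyq' := mul_spectralStep_le y hst
  have hN : (0 : ℝ) ≤ N := Nat.cast_nonneg N
  rw [sub_mul, add_mul, smul_mul_assoc, smul_mul_assoc, smul_mul_assoc, one_mul]
  rcases le_total 0 s with hs | hs
  · have h1 := smul_le_smul_of_nonneg_left (mul_self_mul_spectralStep_le hst hyq hyq') hα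
    have h2 := smul_le_smul_of_nonneg_left (rpow_smul_spectralStep_le hy hp hs hst) hc
    refine (sub_le_sub h1 (add_le_add_left h2 _)).trans ?_
    rw [smul_smul, smul_smul, ← add_smul, ← sub_smul]
    refine smul_le_smul_of_nonneg_right ?_ hq0
    have := h s hs
    have h5 : α * (2 * s * d + d ^ 2) ≤ α * (2 * N + 1) * d := by
      rw [mul_assoc α _ d]
      exact mul_le_mul_of_nonneg_left (by nlinarith) hα
    nlinarith
  -- For `s ≤ 0` the piece only sees values of `y` in `[0, d]`, so its square is negligible without
  -- help from the power.
  · have h1 := mul_self_mul_spectralStep_le (b := d) hst hyq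
      (hyq'.trans (smul_le_smul_of_nonneg_right (by linarith) hq0))
    have h2 : 0 ≤ c • (rieszPow y p * spectralStep y s (s + d)) +
        β • spectralStep y s (s + d) :=
      add_nonneg (smul_nonneg hc (mul_nonneg (rieszPow_nonneg hy hp) hq0)) (smul_nonneg hβ hq0)
    refine (sub_le_self _ h2).trans ((smul_le_smul_of_nonneg_left h1 hα).trans ?_)
    rw [smul_smul]
    refine smul_le_smul_of_nonneg_right (le_trans ?_ hdε) hq0
    rw [mul_assoc]
    exact mul_le_mul_of_nonneg_left (by nlinarith) hα

end SpectralInequalities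

/-! ### Ideal property of `E`, Jensen's inequality and averaging -/

section UniversalCompletion

variable {E U : Type*}
  [AddCommGroup E] [ConditionallyCompleteLattice E] [IsOrderedAddMonoid E]
  [Module ℝ E] [IsOrderedModule ℝ E]
  [CommRing U] [ConditionallyCompleteLattice U] [IsOrderedRing U]
  [Algebra ℝ U] [IsOrderedModule ℝ U] [IsFAlgebra U]
  {ι : E →ₗ[ℝ] U} {T : E →ₗ[ℝ] E}

namespace IsUniversalCompletion

theorem map_le_iff (hι : IsUniversalCompletion ι) {x y : E} : ι x ≤ ι y ↔ x ≤ y := by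
  rw [← sup_eq_right, ← hι.map_sup, hι.injective.eq_iff, sup_eq_right]

theorem map_nonneg_iff (hι : IsUniversalCompletion ι) {x : E} : 0 ≤ ι x ↔ 0 ≤ x := by
  rw [← map_zero ι, hι.map_le_iff]

theorem map_abs (hι : IsUniversalCompletion ι) (x : E) : ι |x| = |ι x| := by
  rw [abs, abs, hι.map_sup, map_neg]

theorem isLUB_of_isLUB_map (hι : IsUniversalCompletion ι) {x : ℕ → E} {s : E}
    (h : IsLUB (Set.range fun m => ι (x m)) (ι s)) : IsLUB (Set.range x) s := by
  constructor
  · rintro _ ⟨m, rfl⟩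
    exact hι.map_le_iff.1 (h.1 ⟨m, rfl⟩)
  · intro b hb
    refine hι.map_le_iff.1 (h.2 ?_)
    rintro _ ⟨m, rfl⟩
    exact hι.map_le_iff.2 (hb ⟨m, rfl⟩)

/-- If the supremum fell short of `u`, order density would give a positive `x` in `E` below the gap.
Adding `x` to any member of the set keeps it below `u`, so the supremum would be at most itself
minus `ι x`. -/
theorem isLUB_below (hι : IsUniversalCompletion ι) {u : U} (hu : 0 ≤ u) :
    IsLUB (ι '' {g | 0 ≤ g ∧ ι g ≤ u}) u := by
  set D : Set E := {g | 0 ≤ g ∧ ι g ≤ u}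
  have hub : u ∈ upperBounds (ι '' D) := by rintro _ ⟨g, hg, rfl⟩; exact hg.2
  have hne : (ι '' D).Nonempty := ⟨ι 0, 0, ⟨le_rfl, by simpa using hu⟩, rfl⟩
  have hs := isLUB_csSup hne ⟨u, hub⟩
  have hsu : sSup (ι '' D) ≤ u := hs.2 hub
  rcases hsu.eq_or_lt with h | h
  · rwa [h] at hs
  · obtain ⟨x, hx0, hx⟩ := hι.orderDense _ (sub_pos.2 h)
    have hx' : 0 ≤ x := hι.map_nonneg_iff.1 hx0.le
    have : sSup (ι '' D) ≤ sSup (ι '' D) - ι x := hs.2 <| by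
      rintro _ ⟨g, hg, rfl⟩
      rw [le_sub_iff_add_le, ← map_add]
      refine hs.1 ⟨g + x, ⟨add_nonneg hg.1 hx', ?_⟩, rfl⟩
      rw [map_add]
      calc ι g + ι x ≤ sSup (ι '' D) + (u - sSup (ι '' D)) := add_le_add (hs.1 ⟨g, hg, rfl⟩) hx
        _ = u := by abel
    exact absurd (le_sub_self_iff _ |>.1 this) (not_le_of_gt hx0)

end IsUniversalCompletion

theorem monotone_of_nonneg (hT : ∀ x, 0 ≤ x → 0 ≤ T x) : Monotone T := fun x y h => by
  rw [← sub_nonneg, ← map_sub]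
  exact hT _ (sub_nonneg.2 h)

theorem mem_range_of_mem_natDomCone (hdom : IsNaturalDomain ι T) {u : U}
    (hu : u ∈ natDomCone ι T) : u ∈ Set.range ι := by
  rw [hdom]
  refine ⟨u, hu, 0, ⟨le_rfl, {0}, Set.singleton_nonempty _, directedOn_singleton _, ?_, ?_, ?_⟩,
    (sub_zero u).symm⟩
  · simp
  · simp
  · simp

/-- The elements of `E` between `0` and `u` increase to `u` and their images are bounded by `T x`,
so `u` belongs to the natural domain. This makes `E` an ideal of `U`. -/
theorem mem_range_of_le (hι : IsUniversalCompletion ι) (hT : ∀ x, 0 ≤ x → 0 ≤ T x)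
    (hdom : IsNaturalDomain ι T) {u : U} {x : E} (hu : 0 ≤ u) (hux : u ≤ ι x) :
    u ∈ Set.range ι := by
  refine mem_range_of_mem_natDomCone hdom
    ⟨hu, {g | 0 ≤ g ∧ ι g ≤ u}, ⟨0, le_rfl, by simpa using hu⟩, ?_, fun g hg => hg.1,
      hι.isLUB_below hu, ι (T x), ?_⟩
  · intro g hg h hh
    exact ⟨g ⊔ h, ⟨hg.1.trans le_sup_left, by rw [hι.map_sup]; exact sup_le hg.2 hh.2⟩,
      le_sup_left, le_sup_right⟩
  · rintro _ ⟨g, hg, rfl⟩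
    exact hι.map_le_iff.2 (monotone_of_nonneg hT (hι.map_le_iff.1 (hg.2.trans hux)))

/-- The square of `x`, taken in the `f`-algebra `U`, lies in `E`. -/
def IsSquareIntegrable (ι : E →ₗ[ℝ] U) (x : E) : Prop := ι x * ι x ∈ Set.range ι

/-- `E` is an order ideal of `U`. -/
def IsSolidRange (ι : E →ₗ[ℝ] U) : Prop := ∀ (u : U) (x : E), 0 ≤ u → u ≤ ι x → u ∈ Set.range ι

namespace IsSquareIntegrable

theorem of_le (hs : IsSolidRange ι) {x z : E} (h : ι x * ι x ≤ ι z) : IsSquareIntegrable ι x :=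
  hs _ z (mul_self_nonneg_of_fAlgebra _) h

theorem zero : IsSquareIntegrable ι (0 : E) := ⟨0, by simp⟩

theorem smul {x : E} (hx : IsSquareIntegrable ι x) (c : ℝ) : IsSquareIntegrable ι (c • x) := by
  obtain ⟨z, hz⟩ := hx
  exact ⟨(c * c) • z, by rw [map_smul, map_smul, hz, smul_mul_smul_comm]⟩

theorem neg {x : E} (hx : IsSquareIntegrable ι x) : IsSquareIntegrable ι (-x) := by
  simpa using hx.smul (-1)

theorem add (hs : IsSolidRange ι) {x y : E} (hx : IsSquareIntegrable ι x)
    (hy : IsSquareIntegrable ι y) : IsSquareIntegrable ι (x + y) := by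
  obtain ⟨a, ha⟩ := hx
  obtain ⟨b, hb⟩ := hy
  refine of_le hs (z := (a + b) + (a + b)) ?_
  simp only [map_add, ha, hb]
  have := mul_self_nonneg_of_fAlgebra (ι x - ι y)
  rw [← sub_nonneg]
  convert this using 1
  ring

theorem of_abs_le (hι : IsUniversalCompletion ι) (hs : IsSolidRange ι) {x y : E}
    (hy : IsSquareIntegrable ι y) (h : |x| ≤ |y|) : IsSquareIntegrable ι x := by
  obtain ⟨z, hz⟩ := hy
  refine of_le hs (z := z) ?_
  rw [hz]
  refine mul_self_le_of_abs_le ?_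
  rw [← hι.map_abs, ← hι.map_abs]
  exact hι.map_le_iff.2 h

theorem sup (hι : IsUniversalCompletion ι) (hs : IsSolidRange ι) {x y : E}
    (hx : IsSquareIntegrable ι x) (hy : IsSquareIntegrable ι y) :
    IsSquareIntegrable ι (x ⊔ y) := by
  have hx' : IsSquareIntegrable ι |x| := hx.of_abs_le hι hs (abs_abs x).le
  have hy' : IsSquareIntegrable ι |y| := hy.of_abs_le hι hs (abs_abs y).le
  refine (hx'.add hs hy').of_abs_le hι hs ?_
  rw [abs_of_nonneg (add_nonneg (abs_nonneg x) (abs_nonneg y))]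
  refine sup_le (sup_le ?_ ?_) ?_
  · exact (le_abs_self x).trans (le_add_of_nonneg_right (abs_nonneg y))
  · exact (le_abs_self y).trans (le_add_of_nonneg_left (abs_nonneg x))
  · exact (neg_le_neg le_sup_left).trans
      ((neg_le_abs x).trans (le_add_of_nonneg_right (abs_nonneg y)))

theorem sum (hs : IsSolidRange ι) {x : ℕ → E} (hx : ∀ i, IsSquareIntegrable ι (x i))
    (n : ℕ) : IsSquareIntegrable ι (∑ i ∈ Finset.range n, x i) := by
  induction n with
  | zero => simpa using zero
  | succ n ih => rw [Finset.sum_range_succ]; exact ih.add hs (hx n)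

/-- Polarization. -/
theorem mul_mem_range (hs : IsSolidRange ι) {x y : E} (hx : IsSquareIntegrable ι x)
    (hy : IsSquareIntegrable ι y) : ι x * ι y ∈ Set.range ι := by
  obtain ⟨c, hc⟩ := hx.add hs hy
  obtain ⟨a, ha⟩ := hx
  obtain ⟨b, hb⟩ := hy
  refine ⟨(1 / 2 : ℝ) • (c - a - b), ?_⟩
  rw [map_smul, map_sub, map_sub, ha, hb, hc, map_add]
  have : (ι x + ι y) * (ι x + ι y) - ι x * ι x - ι y * ι y = (2 : ℝ) • (ι x * ι y) := by
    rw [two_smul]; ring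
  rw [this, smul_smul]
  norm_num

end IsSquareIntegrable

/-- Jensen's inequality for squares: a positive operator fixing `e` preserves each tangent bound `2
t x - t² e ≤ x²`, and the square is the supremum of its tangents. -/
theorem map_mul_self_le (hι : IsUniversalCompletion ι) (hT : ∀ x, 0 ≤ x → 0 ≤ T x)
    {e : E} (he : ι e = 1) (hTe : T e = e) {x z : E} (hz : ι z = ι x * ι x) :
    ι (T x) * ι (T x) ≤ ι (T z) := by
  refine mul_self_le_of_forall_tangent_le _ _ fun t => ?_
  have h : (2 * t) • x - t ^ 2 • e ≤ z := by
    rw [← hι.map_le_iff, map_sub, map_smul, map_smul, he, hz, ← sub_nonneg]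
    convert mul_self_nonneg_of_fAlgebra (ι x - t • (1 : U)) using 1
    simp only [Algebra.smul_def, map_mul, map_pow, map_ofNat]
    ring
  have h2 := hι.map_le_iff.2 (monotone_of_nonneg hT h)
  rwa [map_sub, map_smul, map_smul, hTe, map_sub, map_smul, map_smul, he] at h2

/-- Jensen gives `z ≤ T z`, while `T (T z - z) = 0`; strict positivity closes the gap. -/
theorem map_eq_self_of_square (hι : IsUniversalCompletion ι) (hT : ∀ x, 0 ≤ x → 0 ≤ T x)
    (hTT : ∀ x, T (T x) = T x) (hpos : StrictlyPositiveOperator T)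
    {e : E} (he : ι e = 1) (hTe : T e = e) {x z : E} (hx : T x = x) (hz : ι z = ι x * ι x) :
    T z = z := by
  have h := map_mul_self_le hι hT he hTe hz
  rw [hx, ← hz, hι.map_le_iff] at h
  have h2 := hpos (T z - z) (by
    rw [abs_of_nonneg (sub_nonneg.2 h), map_sub, hTT, sub_self])
  exact sub_eq_zero.1 h2

/-- The averaging property: `T (x h) = 0` if `T x = 0` and `h` lies in the range of `T`. -/
theorem map_mul_eq_zero (hι : IsUniversalCompletion ι) (hT : ∀ x, 0 ≤ x → 0 ≤ T x)
    (hTT : ∀ x, T (T x) = T x) (hpos : StrictlyPositiveOperator T)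
    {e : E} (he : ι e = 1) (hTe : T e = e) {x h g : E} (hx : IsSquareIntegrable ι x)
    (hh : IsSquareIntegrable ι h) (hTx : T x = 0) (hTh : T h = h) (hg : ι g = ι x * ι h) :
    T g = 0 := by
  obtain ⟨a, ha⟩ := hx
  obtain ⟨b, hb⟩ := hh
  have hTb := map_eq_self_of_square hι hT hTT hpos he hTe hTh hb
  -- Jensen for `x + s h`: the terms `s² h²` cancel because `T` fixes `h²`. What remains is affine
  -- in `s` and nonnegative for every real `s`, so its slope vanishes.
  have key : ∀ s : ℝ, 0 ≤ T a + (2 * s) • T g := by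
    intro s
    have h1 := map_mul_self_le hι hT he hTe (x := x + s • h) (z := a + (2 * s) • g + s ^ 2 • b) (by
      simp only [map_add, map_smul, ha, hb, hg]
      simp only [Algebra.smul_def, map_mul, map_pow, map_ofNat]
      ring)
    have h2 : ι (T (x + s • h)) * ι (T (x + s • h)) = ι (s ^ 2 • b) := by
      rw [map_add, map_smul, hTx, hTh, zero_add, map_smul, map_smul, smul_mul_smul_comm, hb, sq]
    rw [h2, hι.map_le_iff, map_add, map_smul, hTb, le_add_iff_nonneg_left, map_add, map_smul] at h1
    exact h1
  refine le_antisymm (nonpos_of_forall_nsmul_le (y := T a) fun n => ?_)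
    (neg_nonpos.1 (nonpos_of_forall_nsmul_le (y := T a) fun n => ?_))
  · have := key (-(n / 2))
    rw [show 2 * (-((n : ℝ) / 2)) = -n by ring, neg_smul, ← sub_eq_add_neg, sub_nonneg] at this
    rwa [← Nat.cast_smul_eq_nsmul ℝ]
  · have := key (n / 2)
    rw [show 2 * ((n : ℝ) / 2) = n by ring, ← neg_le_iff_add_nonneg'] at this
    rw [← Nat.cast_smul_eq_nsmul ℝ, smul_neg]
    exact neg_le.1 this

/-- Order continuity is applied to the differences `s - x m`, which decrease to zero. -/
theorem IsConditionalExpectation.map_le_of_isLUB (hT : IsConditionalExpectation T)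
    {x : ℕ → E} (hx : Monotone x) {s b : E} (hs : IsLUB (Set.range x) s)
    (hb : ∀ m, T (x m) ≤ b) : T s ≤ b := by
  have h := hT.orderContinuous (Set.range fun m => s - x m) (Set.range_nonempty _) ?_ ?_
  · rw [← sub_nonpos]
    refine h.2 ?_
    rintro _ ⟨_, ⟨m, rfl⟩, rfl⟩
    dsimp only
    rw [map_sub]
    exact sub_le_sub_left (hb m) _
  · rintro _ ⟨m, rfl⟩ _ ⟨n, rfl⟩
    exact ⟨_, ⟨max m n, rfl⟩, sub_le_sub_left (hx (le_max_left _ _)) _,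
      sub_le_sub_left (hx (le_max_right _ _)) _⟩
  · constructor
    · rintro _ ⟨m, rfl⟩
      exact sub_nonneg.2 (hs.1 ⟨m, rfl⟩)
    · intro c hc
      have : s ≤ s - c := hs.2 <| by
        rintro _ ⟨m, rfl⟩
        have := hc ⟨m, rfl⟩
        exact le_sub_comm.1 this
      simpa using this

end UniversalCompletion

/-! ### Boundedness of sequences in a laterally complete `f`-algebra -/

section SupComponent

variable {U : Type*} [CommRing U] [ConditionallyCompleteLattice U] [IsOrderedRing U]
  [Algebra ℝ U] [IsOrderedModule ℝ U] [IsFAlgebra U]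

/-- The component of the unit on which some `y m` exceeds `t`. -/
noncomputable def supComponent (y : ℕ → U) (t : ℝ) : U := ⨆ m, upperComponent (y m) t

theorem isLUB_supComponent (y : ℕ → U) (t : ℝ) :
    IsLUB (Set.range fun m => upperComponent (y m) t) (supComponent y t) :=
  isLUB_ciSup ⟨1, by rintro _ ⟨m, rfl⟩; exact upperComponent_le_one _ _⟩

theorem supComponent_nonneg (y : ℕ → U) (t : ℝ) : 0 ≤ supComponent y t :=
  (upperComponent_nonneg (y 0) t).trans ((isLUB_supComponent y t).1 ⟨0, rfl⟩)

theorem supComponent_le_one (y : ℕ → U) (t : ℝ) : supComponent y t ≤ 1 :=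
  (isLUB_supComponent y t).2 (by rintro _ ⟨m, rfl⟩; exact upperComponent_le_one _ _)

theorem supComponent_anti (y : ℕ → U) : Antitone (supComponent y) := by
  intro s t h
  refine (isLUB_supComponent y t).2 ?_
  rintro _ ⟨m, rfl⟩
  exact (upperComponent_anti (y m) h).trans ((isLUB_supComponent y s).1 ⟨m, rfl⟩)

theorem one_sub_supComponent_inf (y : ℕ → U) (t : ℝ) :
    (1 - supComponent y t) ⊓ supComponent y t = 0 := by
  have h0 : 0 ≤ 1 - supComponent y t := sub_nonneg.2 (supComponent_le_one y t)
  refine inf_eq_zero_of_isLUB h0 (supComponent_nonneg y t) (isLUB_supComponent y t) ?_ ?_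
  · rintro _ ⟨m, rfl⟩
    exact upperComponent_nonneg _ _
  · rintro _ ⟨m, rfl⟩
    refine le_antisymm ?_ (le_inf h0 (upperComponent_nonneg _ _))
    rw [← one_sub_upperComponent_inf_self (y m) t]
    exact inf_le_inf_right _ (sub_le_sub_left ((isLUB_supComponent y t).1 ⟨m, rfl⟩) _)

theorem supComponent_mul_of_le (y : ℕ → U) {s t : ℝ} (h : s ≤ t) :
    supComponent y s * supComponent y t = supComponent y t := by
  have h1 : (1 - supComponent y s) ⊓ supComponent y t = 0 := by
    refine le_antisymm ?_ (le_inf (sub_nonneg.2 (supComponent_le_one y s))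
      (supComponent_nonneg y t))
    rw [← one_sub_supComponent_inf y s]
    exact inf_le_inf_left _ (supComponent_anti y h)
  have := mul_eq_zero_of_inf_eq_zero h1
  linear_combination -this

theorem mul_one_sub_supComponent_le (y : ℕ → U) (m : ℕ) (t : ℝ) :
    y m * (1 - supComponent y t) ≤ t • (1 - supComponent y t) := by
  have h1 : (1 - supComponent y t) ⊓ upperComponent (y m) t = 0 := by
    refine le_antisymm ?_ (le_inf (sub_nonneg.2 (supComponent_le_one y t))
      (upperComponent_nonneg _ t))
    rw [← one_sub_supComponent_inf y t]
    exact inf_le_inf_left _ ((isLUB_supComponent y t).1 ⟨m, rfl⟩)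
  have h2 := mul_eq_zero_of_inf_eq_zero h1
  have h3 := mul_le_mul_of_nonneg_right (mul_one_sub_upperComponent_le (y m) t)
    (sub_nonneg.2 (supComponent_le_one y t))
  have h4 : (1 - upperComponent (y m) t) * (1 - supComponent y t) = 1 - supComponent y t := by
    linear_combination -h2
  rwa [mul_assoc, smul_mul_assoc, h4] at h3

theorem supComponent_neg_one {y : ℕ → U} (hy : ∀ m, 0 ≤ y m) : supComponent y (-1) = 1 := by
  refine le_antisymm (supComponent_le_one y _) ?_
  refine le_trans ?_ ((isLUB_supComponent y (-1)).1 ⟨0, rfl⟩)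
  refine le_trans ?_ ((isLUB_upperComponent (y 0) (-1)).1 ⟨1, rfl⟩)
  refine le_inf le_rfl ?_
  rw [one_nsmul, neg_smul, one_smul, sub_neg_eq_add]
  exact le_sup_of_le_left (le_add_of_nonneg_left (hy 0))

theorem nsmul_inf_nsmul_eq_zero {a b : U} (h : a ⊓ b = 0) (m n : ℕ) : (m • a) ⊓ (n • b) = 0 := by
  have h1 := IsFAlgebra.mul_inf_eq_zero a b (m : U) h (Nat.cast_nonneg m)
  rw [inf_comm] at h1
  have h2 := IsFAlgebra.mul_inf_eq_zero _ _ (n : U) h1 (Nat.cast_nonneg n)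
  rwa [inf_comm, ← nsmul_eq_mul, ← nsmul_eq_mul] at h2

/-- In a laterally complete `f`-algebra, a sequence of positive elements is bounded above provided
that the components `{sup y > n}` decrease to `0`. -/
theorem LaterallyComplete.bddAbove_of_supComponent (hU : LaterallyComplete U) {y : ℕ → U}
    (hy : ∀ m, 0 ≤ y m)
    (h : ∀ z : U, 0 ≤ z → (∀ n : ℕ, z ≤ supComponent y n) → z = 0) :
    BddAbove (Set.range y) := by
  -- The shift by one makes `P 0` the whole unit, so the pieces `P n - P (n + 1)`, on which `n - 1 <
  -- sup y ≤ n`, start with all small values of the supremum.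
  set P : ℕ → U := fun n => supComponent y ((n : ℝ) - 1) with hP
  have hP0 : P 0 = 1 := by
    simp only [hP, Nat.cast_zero, zero_sub]
    exact supComponent_neg_one hy
  have hanti : Antitone P := fun i j hij =>
    supComponent_anti y (sub_le_sub_right (Nat.cast_le.2 hij) _)
  have hPP : ∀ {i j}, i ≤ j → P i * P j = P j := fun hij =>
    supComponent_mul_of_le y (sub_le_sub_right (Nat.cast_le.2 hij) _)
  have hr0 : ∀ n, 0 ≤ P n - P (n + 1) := fun n => sub_nonneg.2 (hanti n.le_succ)
  have hrr : ∀ n, (P n - P (n + 1)) * (P n - P (n + 1)) = P n - P (n + 1) := by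
    intro n
    linear_combination hPP (le_refl n) + hPP (le_refl (n + 1)) - 2 * hPP n.le_succ
  have hdisj : ∀ {i j}, i < j → (P i - P (i + 1)) ⊓ (P j - P (j + 1)) = 0 := by
    intro i j hij
    refine le_antisymm ?_ (le_inf (hr0 i) (hr0 j))
    have h1 : P i - P (i + 1) ≤ 1 - P (i + 1) :=
      sub_le_sub_right (supComponent_le_one _ _) _
    have h2 : P j - P (j + 1) ≤ P (i + 1) :=
      (sub_le_self _ (supComponent_nonneg _ _)).trans (hanti hij)
    exact (inf_le_inf h1 h2).trans (one_sub_supComponent_inf y _).le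
  -- The candidate bound takes the value `n` on the `n`-th piece, that is, it rounds the supremum of
  -- `y` up to an integer.
  obtain ⟨f, hf⟩ := hU (Set.range fun n : ℕ => n • (P n - P (n + 1))) (Set.range_nonempty _)
    (by rintro _ ⟨n, rfl⟩; exact nsmul_nonneg (hr0 n) n) (by
      rintro _ ⟨i, rfl⟩ _ ⟨j, rfl⟩ hne
      rcases lt_trichotomy i j with hij | rfl | hij
      · exact nsmul_inf_nsmul_eq_zero (hdisj hij) i j
      · exact absurd rfl hne
      · rw [inf_comm]
        exact nsmul_inf_nsmul_eq_zero (hdisj hij) j i)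
  refine ⟨f, ?_⟩
  rintro _ ⟨m, rfl⟩
  have hstep : ∀ n, (y m - f) * (P n - P (n + 1)) ≤ 0 := by
    intro n
    have h1 := mul_le_mul_of_nonneg_right
      (mul_one_sub_supComponent_le y m (((n + 1 : ℕ) : ℝ) - 1)) (hr0 n)
    have h2 : (1 - P (n + 1)) * (P n - P (n + 1)) = P n - P (n + 1) := by
      linear_combination hPP (le_refl (n + 1)) - hPP n.le_succ
    have h3 : ((n + 1 : ℕ) : ℝ) - 1 = n := by push_cast; ring
    change y m * (1 - P (n + 1)) * _ ≤ ((((n + 1 : ℕ) : ℝ) - 1) • (1 - P (n + 1))) * _ at h1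
    rw [mul_assoc, smul_mul_assoc, h2, h3, Nat.cast_smul_eq_nsmul] at h1
    have h4 := mul_le_mul_of_nonneg_right (hf.1 ⟨n, rfl⟩) (hr0 n)
    dsimp only at h4
    rw [smul_mul_assoc, hrr] at h4
    rw [sub_mul, sub_nonpos]
    exact h1.trans h4
  have hsum : ∀ n, (y m - f) * (1 - P n) ≤ 0 := by
    intro n
    induction n with
    | zero => rw [hP0]; simp
    | succ n ih =>
      have : (y m - f) * (1 - P (n + 1)) =
          (y m - f) * (1 - P n) + (y m - f) * (P n - P (n + 1)) := by ring
      rw [this]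
      exact add_nonpos ih (hstep n)
  -- The excess of `y m` over `f` vanishes off every `P n`, so its truncation `w ⊓ 1` lies below all
  -- the components `{sup y > n}` and is zero.
  set w := (y m - f)⁺ with hw
  have hw0 : 0 ≤ w := posPart_nonneg _
  have hz0 : 0 ≤ w ⊓ 1 := le_inf hw0 zero_le_one
  have hz : w ⊓ 1 = 0 := by
    refine h _ hz0 fun n => ?_
    have e : supComponent y n = P (n + 1) := by simp [hP]
    rw [e]
    have hQ : 0 ≤ 1 - P (n + 1) := sub_nonneg.2 (supComponent_le_one _ _)
    have h1 : w * (1 - P (n + 1)) ≤ 0 := by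
      rw [hw, ← mul_upperComponent_zero, mul_right_comm]
      exact mul_nonpos_of_nonpos_of_nonneg (hsum _) (upperComponent_nonneg _ _)
    have h2 := (mul_le_mul_of_nonneg_right (inf_le_left : w ⊓ 1 ≤ w) hQ).trans h1
    rw [mul_sub, mul_one, sub_nonpos] at h2
    refine h2.trans ((mul_le_mul_of_nonneg_right inf_le_right
      (supComponent_nonneg _ _)).trans (one_mul _).le)
  have := mul_eq_zero_of_inf_eq_zero hz
  rw [mul_one] at this
  exact sub_nonpos.1 ((le_posPart _).trans this.le)

end SupComponent

/-! ### Monotone convergence in the natural domain -/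

section Boundedness

variable {E U : Type*}
  [AddCommGroup E] [ConditionallyCompleteLattice E] [IsOrderedAddMonoid E]
  [Module ℝ E] [IsOrderedModule ℝ E]
  [CommRing U] [ConditionallyCompleteLattice U] [IsOrderedRing U]
  [Algebra ℝ U] [IsOrderedModule ℝ U] [IsFAlgebra U]
  {ι : E →ₗ[ℝ] U} {T : E →ₗ[ℝ] E}

/-- Monotone convergence in the natural domain: an increasing sequence of positive elements whose
images under `T` are bounded is itself bounded. -/
theorem bddAbove_of_map_le (hι : IsUniversalCompletion ι) {e : E} (he : ι e = 1)
    (hT : IsConditionalExpectation T) (hpos : StrictlyPositiveOperator T)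
    (hdom : IsNaturalDomain ι T) {g : ℕ → E} (hg : Monotone g) (hg0 : ∀ m, 0 ≤ g m) {C : E}
    (hC : ∀ m, T (g m) ≤ C) : BddAbove (Set.range g) := by
  have hy : ∀ m, 0 ≤ ι (g m) := fun m => hι.map_nonneg_iff.2 (hg0 m)
  have hmem : ∀ u : U, 0 ≤ u → u ≤ 1 → u ∈ Set.range ι := fun u h0 h1 =>
    mem_range_of_le hι hT.nonneg hdom (x := e) h0 (h1.trans he.ge)
  have hb : BddAbove (Set.range fun m => ι (g m)) := by
    refine hι.laterallyComplete.bddAbove_of_supComponent hy fun z hz0 hz => ?_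
    obtain ⟨z', rfl⟩ := hmem z hz0 ((hz 0).trans (supComponent_le_one _ _))
    have hz0' := hι.map_nonneg_iff.1 hz0
    -- Chebyshev's inequality bounds `n T {g m > n}` by `C`; order continuity extends this to the
    -- supremum over `m`, which dominates `z'`. Thus `n T z' ≤ C` for all `n`.
    have hTz : T z' ≤ 0 := by
      refine nonpos_of_forall_nsmul_le (y := C) fun n => ?_
      rcases Nat.eq_zero_or_pos n with rfl | hn
      · rw [zero_smul]
        exact (hT.nonneg _ (hg0 0)).trans (hC 0)
      have hn' : (0 : ℝ) < n := by exact_mod_cast hn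
      obtain ⟨c, hc⟩ := hmem _ (supComponent_nonneg (fun m => ι (g m)) n)
        (supComponent_le_one _ _)
      have hcm : ∀ m, ∃ d, ι d = upperComponent (ι (g m)) n := fun m =>
        hmem _ (upperComponent_nonneg _ _) (upperComponent_le_one _ _)
      choose d hd using hcm
      have hlub : IsLUB (Set.range d) c := by
        refine hι.isLUB_of_isLUB_map ?_
        simp only [hd, hc]
        exact isLUB_supComponent (fun m => ι (g m)) n
      have hdm : Monotone d := fun i j hij => by
        rw [← hι.map_le_iff, hd, hd]
        exact upperComponent_mono_left (hι.map_le_iff.2 (hg hij)) _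
      have hle : ∀ m, T (d m) ≤ (n : ℝ)⁻¹ • C := by
        intro m
        have h1 : (n : ℝ) • d m ≤ g m := by
          rw [← hι.map_le_iff, map_smul, hd]
          exact (smul_upperComponent_le _ _).trans
            (mul_le_of_le_one_right (hy m) (upperComponent_le_one _ _))
        have h2 := (monotone_of_nonneg hT.nonneg h1).trans (hC m)
        rw [map_smul] at h2
        have h3 := smul_le_smul_of_nonneg_left h2 (inv_nonneg.2 hn'.le)
        rwa [smul_smul, inv_mul_cancel₀ hn'.ne', one_smul] at h3
      have h4 := hT.map_le_of_isLUB hdm hlub hle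
      have h5 : z' ≤ c := by
        rw [← hι.map_le_iff, hc]
        exact hz n
      have h6 := smul_le_smul_of_nonneg_left ((monotone_of_nonneg hT.nonneg h5).trans h4) hn'.le
      rwa [smul_smul, mul_inv_cancel₀ hn'.ne', one_smul, Nat.cast_smul_eq_nsmul] at h6
    have : z' = 0 := hpos z' (by
      rw [abs_of_nonneg hz0']
      exact le_antisymm hTz (hT.nonneg _ hz0'))
    rw [this, map_zero]
  have hs := isLUB_ciSup hb
  -- The supremum, so far only in `U`, lies in the natural domain and hence comes from `E`.
  obtain ⟨b, hb'⟩ := mem_range_of_mem_natDomCone hdom (u := ⨆ m, ι (g m))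
    ⟨(hy 0).trans (hs.1 ⟨0, rfl⟩), Set.range g, Set.range_nonempty _,
      directedOn_range.2 hg.directed_le, by rintro _ ⟨m, rfl⟩; exact hg0 m,
      by rw [← Set.range_comp]; exact hs,
      ι C, by rintro _ ⟨_, ⟨m, rfl⟩, rfl⟩; exact hι.map_le_iff.2 (hC m)⟩
  refine ⟨b, ?_⟩
  rintro _ ⟨m, rfl⟩
  rw [← hι.map_le_iff, hb']
  exact hs.1 ⟨m, rfl⟩

end Boundedness

/-! ### Kronecker's lemma -/

section Kronecker

variable {E : Type*} [AddCommGroup E] [ConditionallyCompleteLattice E] [IsOrderedAddMonoid E]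
  [Module ℝ E] [IsOrderedModule ℝ E]

theorem abs_smul_of_nonneg_scalar {c : ℝ} (hc : 0 ≤ c) (x : E) : |c • x| ≤ c • |x| := by
  refine sup_le (smul_le_smul_of_nonneg_left (le_abs_self x) hc) ?_
  rw [← smul_neg]
  exact smul_le_smul_of_nonneg_left (neg_le_abs x) hc

/-- The sums `∑_{j ≤ n} (a j - a (j - 1)) D j`, where `a (-1) = 0`. -/
def weightedSum (a : ℕ → ℝ) (D : ℕ → E) : ℕ → E
  | 0 => a 0 • D 0
  | n + 1 => weightedSum a D n + (a (n + 1) - a n) • D (n + 1)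

variable {a : ℕ → ℝ} {D : ℕ → E}

theorem smul_le_weightedSum (ha_pos : ∀ i, 0 < a i) (hD : Antitone D) (n : ℕ) :
    a n • D n ≤ weightedSum a D n := by
  induction n with
  | zero => exact le_rfl
  | succ n ih =>
    have h1 := smul_le_smul_of_nonneg_left (hD n.le_succ) (ha_pos n).le
    rw [weightedSum, sub_smul, add_sub, le_sub_iff_add_le, add_comm]
    exact add_le_add_left (h1.trans ih) _

/-- The terms up to index `m` are bounded using `D 0`, the later ones using `D m`. -/
theorem weightedSum_le (ha_mono : Monotone a) (hD : Antitone D) (m n : ℕ) :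
    weightedSum a D (m + n) ≤ a m • D 0 + (a (m + n) - a m) • D m := by
  induction n with
  | zero =>
    simp only [add_zero, sub_self, zero_smul]
    induction m with
    | zero => exact le_rfl
    | succ m ih =>
      have h1 := smul_le_smul_of_nonneg_left (hD (m + 1).zero_le)
        (sub_nonneg.2 (ha_mono m.le_succ))
      refine (add_le_add ih h1).trans ?_
      rw [← add_smul, add_sub_cancel]
  | succ n ih =>
    have h1 := smul_le_smul_of_nonneg_left (hD (show m ≤ m + n + 1 by omega))
      (sub_nonneg.2 (ha_mono (m + n).le_succ))
    refine (add_le_add ih h1).trans ?_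
    rw [add_assoc, ← add_smul, ← add_assoc m n 1, Nat.succ_eq_add_one]
    refine le_of_eq ?_
    congr 2
    ring

/-- Kronecker's lemma for sequences that are order Cauchy. -/
theorem orderTendsto_zero_of_orderCauchy (ha_pos : ∀ i, 0 < a i) (ha_mono : Monotone a)
    (ha : Filter.Tendsto a Filter.atTop Filter.atTop) (hD : Antitone D)
    (hD0 : IsGLB (Set.range D) 0) {Y : ℕ → E}
    (h : ∀ n i j, n ≤ i → n ≤ j → |∑ l ∈ Finset.range i, (1 / a l) • Y l -
      ∑ l ∈ Finset.range j, (1 / a l) • Y l| ≤ D n) :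
    OrderTendsto (fun n => (1 / a n) • ∑ i ∈ Finset.range (n + 1), Y i) 0 := by
  set M : ℕ → E := fun n => ∑ l ∈ Finset.range n, (1 / a l) • Y l with hM
  have hMs : ∀ n, M (n + 1) = M n + (1 / a n) • Y n := fun n => Finset.sum_range_succ _ n
  have hM0 : M 0 = 0 := Finset.sum_range_zero _
  have haY : ∀ n, a n • (1 / a n) • Y n = Y n := fun n => by
    rw [smul_smul, mul_one_div_cancel (ha_pos n).ne', one_smul]
  -- Summation by parts: the quantity inside is `∑_{j ≤ n} (a j - a (j - 1)) (M k - M j)`. The late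
  -- partial sum `M k` plays the role of the limit, so none is needed.
  have hAbel : ∀ n k, n ≤ k → |∑ i ∈ Finset.range (n + 1), Y i - a n • (M (n + 1) - M k)| ≤
      weightedSum a D n := by
    intro n
    induction n with
    | zero =>
      intro k _
      have e : ∑ i ∈ Finset.range (0 + 1), Y i - a 0 • (M (0 + 1) - M k) =
          a 0 • (M k - M 0) := by
        rw [hMs, smul_sub, smul_add, haY, hM0]
        simp
      rw [e]
      exact (abs_smul_of_nonneg_scalar (ha_pos 0).le _).trans
        (smul_le_smul_of_nonneg_left (h 0 k 0 k.zero_le le_rfl) (ha_pos 0).le)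
    | succ n ih =>
      intro k hk
      have hb : 0 ≤ a (n + 1) - a n := sub_nonneg.2 (ha_mono n.le_succ)
      have e : ∑ i ∈ Finset.range (n + 1 + 1), Y i - a (n + 1) • (M (n + 1 + 1) - M k) =
          (∑ i ∈ Finset.range (n + 1), Y i - a n • (M (n + 1) - M k)) +
            (a (n + 1) - a n) • (M k - M (n + 1)) := by
        rw [Finset.sum_range_succ _ (n + 1), hMs (n + 1)]
        have hY' := haY (n + 1)
        generalize (1 / a (n + 1)) • Y (n + 1) = x at hY' ⊢
        rw [← hY']
        module
      rw [e]
      refine (abs_add_le _ _).trans (add_le_add (ih k (by omega)) ?_)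
      exact (abs_smul_of_nonneg_scalar hb _).trans
        (smul_le_smul_of_nonneg_left (h (n + 1) k (n + 1) hk le_rfl) hb)
  -- The dominating sequence consists of weighted averages of `D 0, …, D n`; these decrease because
  -- `D` does.
  refine ⟨fun n => (1 / a n) • weightedSum a D n, antitone_nat_of_succ_le fun n => ?_, ?_, ?_⟩
  · have h0 := ha_pos n
    have h1 := ha_pos (n + 1)
    have h2 : weightedSum a D (n + 1) ≤ (a (n + 1) / a n) • weightedSum a D n := by
      have h3 : a n • D (n + 1) ≤ weightedSum a D n :=
        (smul_le_smul_of_nonneg_left (hD n.le_succ) h0.le).trans (smul_le_weightedSum ha_pos hD n)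
      have h4 := smul_le_smul_of_nonneg_left h3
        (show 0 ≤ (a (n + 1) - a n) / a n from
          div_nonneg (sub_nonneg.2 (ha_mono n.le_succ)) h0.le)
      rw [smul_smul, div_mul_cancel₀ _ h0.ne'] at h4
      refine (add_le_add_right h4 _).trans (le_of_eq ?_)
      nth_rw 1 [← one_smul ℝ (weightedSum a D n)]
      rw [← add_smul]
      congr 1
      field_simp
      ring
    refine (smul_le_smul_of_nonneg_left h2 (one_div_nonneg.2 h1.le)).trans (le_of_eq ?_)
    rw [smul_smul]
    congr 1
    field_simp
  · have hDn : ∀ n, 0 ≤ D n := fun n => hD0.1 ⟨n, rfl⟩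
    constructor
    · rintro _ ⟨n, rfl⟩
      exact smul_nonneg (one_div_nonneg.2 (ha_pos n).le)
        ((smul_nonneg (ha_pos n).le (hDn n)).trans (smul_le_weightedSum ha_pos hD n))
    · intro z hz
      refine hD0.2 ?_
      rintro _ ⟨m, rfl⟩
      rw [← sub_nonpos]
      refine nonpos_of_forall_le_smul (hDn 0) fun ε hε => ?_
      -- For such `n` the terms up to index `m` carry weight at most `ε` in the average, and the
      -- others are at most `D m`.
      obtain ⟨n, hn, hmn⟩ :=
        ((ha.eventually_ge_atTop (a m / ε)).and (Filter.eventually_ge_atTop m)).exists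
      obtain ⟨k, rfl⟩ := Nat.exists_eq_add_of_le hmn
      have h0 := ha_pos (m + k)
      have h1 := (hz ⟨m + k, rfl⟩).trans (smul_le_smul_of_nonneg_left
        (weightedSum_le ha_mono hD m k) (one_div_nonneg.2 h0.le))
      rw [sub_le_iff_le_add]
      refine h1.trans ?_
      rw [smul_add, smul_smul, smul_smul]
      refine add_le_add (smul_le_smul_of_nonneg_right ?_ (hDn 0)) ?_
      · rw [one_div_mul_eq_div, div_le_iff₀ h0, mul_comm]
        exact (div_le_iff₀ hε).1 hn
      · nth_rw 2 [← one_smul ℝ (D m)]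
        refine smul_le_smul_of_nonneg_right ?_ (hDn m)
        rw [one_div_mul_eq_div, div_le_one h0]
        linarith [ha_pos m]
  · intro n
    have := hAbel n (n + 1) n.le_succ
    rw [sub_self, smul_zero, sub_zero] at this
    dsimp only
    rw [sub_zero]
    exact (abs_smul_of_nonneg_scalar (one_div_nonneg.2 (ha_pos n).le) _).trans
      (smul_le_smul_of_nonneg_left this (one_div_nonneg.2 (ha_pos n).le))

end Kronecker

/-! ### Pathwise maximal inequalities -/

section Maximal

/-- The maximum of `0` and the first partial sums of `X`. -/
def runningMax {E : Type*} [AddCommGroup E] [Lattice E] (X : ℕ → E) : ℕ → E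
  | 0 => 0
  | j + 1 => runningMax X j ⊔ ∑ i ∈ Finset.range (j + 1), X i

theorem runningMax_mono {E : Type*} [AddCommGroup E] [Lattice E] (X : ℕ → E) :
    Monotone (runningMax X) :=
  monotone_nat_of_le_succ fun _ => le_sup_left

theorem runningMax_nonneg {E : Type*} [AddCommGroup E] [Lattice E] (X : ℕ → E) (j : ℕ) :
    0 ≤ runningMax X j :=
  runningMax_mono X j.zero_le

theorem sum_le_runningMax {E : Type*} [AddCommGroup E] [Lattice E] (X : ℕ → E) (j : ℕ) :
    ∑ i ∈ Finset.range j, X i ≤ runningMax X j := by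
  cases j with
  | zero => simp [runningMax]
  | succ j => exact le_sup_right

variable {E U : Type*}
  [AddCommGroup E] [ConditionallyCompleteLattice E] [IsOrderedAddMonoid E]
  [Module ℝ E] [IsOrderedModule ℝ E]
  [CommRing U] [ConditionallyCompleteLattice U] [IsOrderedRing U]
  [Algebra ℝ U] [IsOrderedModule ℝ U] [IsFAlgebra U]
  {ι : E →ₗ[ℝ] U} {T : ℕ → E →ₗ[ℝ] E}

theorem sup_sub_mul_sup_sub_eq_zero (x y : U) : (x ⊔ y - x) * (x ⊔ y - y) = 0 := by
  have h1 : x ⊔ y - x = (y - x)⁺ := by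
    rw [posPart_def, sup_sub, sub_self, sup_comm]
  have h2 : x ⊔ y - y = (y - x)⁻ := by
    rw [negPart_def, neg_sub, sup_sub, sub_self]
  rw [h1, h2]
  exact posPart_mul_negPart _

/-- A pathwise form of Doob's `L²` maximal inequality. -/
theorem runningMax_pathwise (hι : IsUniversalCompletion ι) (X : ℕ → E) (j : ℕ) :
    (∑ i ∈ Finset.range j, ι (X i) * ι (runningMax X i)) +
        (∑ i ∈ Finset.range j, ι (X i) * ι (runningMax X i)) +
        ι (runningMax X j) * ι (runningMax X j) ≤
      ι (runningMax X j) * ι (∑ i ∈ Finset.range j, X i) +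
        ι (runningMax X j) * ι (∑ i ∈ Finset.range j, X i) := by
  induction j with
  | zero => simp [runningMax]
  | succ j ih =>
    -- The maximum moves only where it equals the new partial sum. Hence the gap between the two
    -- sides grows by exactly the square of the increment of the maximum.
    have h1 := sup_sub_mul_sup_sub_eq_zero (ι (runningMax X j))
      (ι (∑ i ∈ Finset.range (j + 1), X i))
    rw [← hι.map_sup] at h1
    change (ι (runningMax X (j + 1)) - _) * (ι (runningMax X (j + 1)) - _) = 0 at h1
    have h2 := mul_self_nonneg_of_fAlgebra (ι (runningMax X (j + 1)) - ι (runningMax X j))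
    rw [Finset.sum_range_succ (fun i => ι (X i) * ι (runningMax X i))]
    have h3 : ι (∑ i ∈ Finset.range (j + 1), X i) = ι (∑ i ∈ Finset.range j, X i) + ι (X j) := by
      rw [Finset.sum_range_succ, map_add]
    rw [h3] at h1 ⊢
    rw [← sub_nonneg] at ih ⊢
    refine (add_nonneg ih h2).trans (le_of_eq ?_)
    linear_combination 2 * h1

/-- With `m` the maximum and `s` the final sum, the difference of the two sides is `(ε - m/2)² + (s
- m/2)²` plus half the gap in the pathwise inequality. A bound linear in `m` is what monotone
convergence and strict positivity require. -/
theorem smul_runningMax_le (hι : IsUniversalCompletion ι) (X : ℕ → E) (j : ℕ) (ε : ℝ) :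
    ε • ι (runningMax X j) + ∑ i ∈ Finset.range j, ι (X i) * ι (runningMax X i) ≤
      ε ^ 2 • (1 : U) + ι (∑ i ∈ Finset.range j, X i) * ι (∑ i ∈ Finset.range j, X i) := by
  have h := runningMax_pathwise hι X j
  set m := ι (runningMax X j)
  set s := ι (∑ i ∈ Finset.range j, X i)
  set A := ∑ i ∈ Finset.range j, ι (X i) * ι (runningMax X i)
  have h1 := mul_self_nonneg_of_fAlgebra (ε • (1 : U) - (1 / 2 : ℝ) • m)
  have h2 := mul_self_nonneg_of_fAlgebra (s - (1 / 2 : ℝ) • m)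
  have h3 := smul_nonneg (show (0 : ℝ) ≤ 1 / 2 by norm_num) (sub_nonneg.2 h)
  rw [← sub_nonneg]
  refine (add_nonneg (add_nonneg h1 h2) h3).trans (le_of_eq ?_)
  have hh : (2 : U) * algebraMap ℝ U (1 / 2) = 1 := by
    rw [← map_ofNat (algebraMap ℝ U) 2, ← map_mul]; norm_num
  simp only [Algebra.smul_def, map_pow]
  set c := algebraMap ℝ U (1 / 2)
  linear_combination (c * m ^ 2 - A - algebraMap ℝ U ε * m) * hh
end Maximal

/-! ### Order Cauchy property of L²-bounded martingales -/

section MartingaleConvergence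

variable {E U : Type*}
  [AddCommGroup E] [ConditionallyCompleteLattice E] [IsOrderedAddMonoid E]
  [Module ℝ E] [IsOrderedModule ℝ E]
  [CommRing U] [ConditionallyCompleteLattice U] [IsOrderedRing U]
  [Algebra ℝ U] [IsOrderedModule ℝ U] [IsFAlgebra U]
  {ι : E →ₗ[ℝ] U} {T : ℕ → E →ₗ[ℝ] E}

namespace IsRieszFiltration

theorem zero_comp (hT : IsRieszFiltration T) (i : ℕ) (x : E) : T 0 (T i x) = T 0 x := by
  rcases Nat.eq_zero_or_pos i with rfl | hi
  · exact (hT.condExp 0).projection x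
  · exact hT.comp_left 0 i hi x

theorem map_of_mem_range (hT : IsRieszFiltration T) {i j : ℕ} (hij : i ≤ j) {x : E}
    (hx : x ∈ Set.range (T i)) : T j x = x := by
  obtain ⟨y, rfl⟩ := hx
  rcases hij.eq_or_lt with rfl | h
  · exact (hT.condExp i).projection y
  · exact hT.comp_right i j h y

theorem range_mono (hT : IsRieszFiltration T) {i j : ℕ} (hij : i ≤ j) :
    Set.range (T i) ⊆ Set.range (T j) := fun x hx => ⟨x, hT.map_of_mem_range hij hx⟩

theorem strictlyPositive (hT : IsRieszFiltration T) (h0 : StrictlyPositiveOperator (T 0))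
    (i : ℕ) : StrictlyPositiveOperator (T i) := fun f hf =>
  h0 f (by rw [← hT.zero_comp i, hf, map_zero])

theorem map_unit (hT : IsRieszFiltration T) {e : E} (he : T 0 e = e) (i : ℕ) : T i e = e :=
  hT.map_of_mem_range i.zero_le ⟨e, he⟩

end IsRieszFiltration

theorem sum_mem_range_of_forall_mem (hT : IsRieszFiltration T) {X : ℕ → E} {k : ℕ} :
    ∀ j, (∀ i < j, X i ∈ Set.range (T k)) → ∑ i ∈ Finset.range j, X i ∈ Set.range (T k)
  | 0, _ => ⟨0, by simp⟩
  | j + 1, h => by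
    obtain ⟨y, hy⟩ := sum_mem_range_of_forall_mem hT (X := X) j fun i hi => h i (by omega)
    obtain ⟨x, hx⟩ := h j (by omega)
    exact ⟨y + x, by rw [Finset.sum_range_succ, map_add, hy, hx]⟩

theorem runningMax_mem_range (hT : IsRieszFiltration T) {X : ℕ → E} {k : ℕ} :
    ∀ j, (∀ i < j, X i ∈ Set.range (T k)) → runningMax X j ∈ Set.range (T k)
  | 0, _ => ⟨0, by simp [runningMax]⟩
  | j + 1, h => (hT.condExp k).range_sup _
      (runningMax_mem_range hT j fun i hi => h i (by omega)) _
      (sum_mem_range_of_forall_mem hT (j + 1) h)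

theorem IsSquareIntegrable.runningMax (hι : IsUniversalCompletion ι) (hs : IsSolidRange ι)
    {X : ℕ → E} (hX : ∀ i, IsSquareIntegrable ι (X i)) :
    ∀ j, IsSquareIntegrable ι (runningMax X j)
  | 0 => IsSquareIntegrable.zero
  | j + 1 => (IsSquareIntegrable.runningMax hι hs hX j).sup hι hs (IsSquareIntegrable.sum hs hX _)

/-- The data common to the martingale estimates: `E` is the natural domain of a strictly positive
`T 0` fixing the unit `e`, and `X` is a martingale difference sequence with squares `z` in `E`. -/
structure IsSquareMartingaleDifference (ι : E →ₗ[ℝ] U) (e : E) (T : ℕ → E →ₗ[ℝ] E)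
    (X z : ℕ → E) : Prop where
  completion : IsUniversalCompletion ι
  map_unit : ι e = 1
  strictlyPositive : StrictlyPositiveOperator (T 0)
  fixes_unit : T 0 e = e
  naturalDomain : IsNaturalDomain ι (T 0)
  martingale : IsMartingaleDifference X T
  square : ∀ i, ι (z i) = ι (X i) * ι (X i)

namespace IsSquareMartingaleDifference

variable {e : E} {X z : ℕ → E}

theorem neg (h : IsSquareMartingaleDifference ι e T X z) :
    IsSquareMartingaleDifference ι e T (-X) z where
  completion := h.completion
  map_unit := h.map_unit
  strictlyPositive := h.strictlyPositive
  fixes_unit := h.fixes_unit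
  naturalDomain := h.naturalDomain
  martingale :=
    { filtration := h.martingale.filtration
      adapted := fun i => by
        obtain ⟨y, hy⟩ := h.martingale.adapted i
        exact ⟨-y, by rw [map_neg, hy]; rfl⟩
      diff := fun i => by rw [Pi.neg_apply, map_neg, h.martingale.diff, neg_zero] }
  square := fun i => by rw [Pi.neg_apply, map_neg, neg_mul_neg, h.square]

theorem squareIntegrable (h : IsSquareMartingaleDifference ι e T X z) (i : ℕ) :
    IsSquareIntegrable ι (X i) := ⟨z i, h.square i⟩

theorem solid (h : IsSquareMartingaleDifference ι e T X z) : IsSolidRange ι :=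
  fun _ _ h0 h1 => mem_range_of_le h.completion (h.martingale.filtration.condExp 0).nonneg
    h.naturalDomain h0 h1

theorem map_mul_eq_zero (h : IsSquareMartingaleDifference ι e T X z) {k : ℕ} {y g : E}
    (hy : IsSquareIntegrable ι y) (hyT : y ∈ Set.range (T k)) (hg : ι g = ι (X (k + 1)) * ι y) :
    T 0 g = 0 := by
  have hf := h.martingale.filtration
  rw [← hf.zero_comp k, _root_.map_mul_eq_zero h.completion (hf.condExp k).nonneg
    (hf.condExp k).projection (hf.strictlyPositive h.strictlyPositive k) h.map_unit
    (hf.map_unit h.fixes_unit k) (h.squareIntegrable (k + 1)) hy (h.martingale.diff k)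
    (hf.map_of_mem_range le_rfl hyT) hg, map_zero]

/-- Increments after time `n + j` are orthogonal to functions of the increments between
`n` and `n + j`. -/
theorem exists_mul (h : IsSquareMartingaleDifference ι e T X z) (n j : ℕ) {y : E}
    (hy : IsSquareIntegrable ι y) (hy0 : j = 0 → y = 0)
    (hyT : ∀ k, (∀ i < j, X (n + i) ∈ Set.range (T k)) → y ∈ Set.range (T k)) :
    ∃ g, ι g = ι (X (n + j)) * ι y ∧ T 0 g = 0 := by
  cases j with
  -- For `n = 0` no earlier operator annihilates the first increment, so `y` must vanish here; empty
  -- sums and the initial running maximum do.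
  | zero => exact ⟨0, by simp [hy0 rfl], by simp⟩
  | succ j =>
    obtain ⟨g, hg⟩ := (h.squareIntegrable (n + (j + 1))).mul_mem_range h.solid hy
    refine ⟨g, hg, h.map_mul_eq_zero (k := n + j) hy (hyT _ fun i hi => ?_) hg⟩
    exact h.martingale.filtration.range_mono (by omega) (h.martingale.adapted (n + i))

/-- Pythagoras: `T 0` annihilates the cross terms. -/
theorem exists_sum_square (h : IsSquareMartingaleDifference ι e T X z) (n j : ℕ) :
    ∃ q, ι q = ι (∑ i ∈ Finset.range j, X (n + i)) * ι (∑ i ∈ Finset.range j, X (n + i)) ∧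
      T 0 q = ∑ i ∈ Finset.range j, T 0 (z (n + i)) := by
  induction j with
  | zero => exact ⟨0, by simp, by simp⟩
  | succ j ih =>
    obtain ⟨q, hq, hTq⟩ := ih
    obtain ⟨g, hg, hTg⟩ := h.exists_mul n j
      (IsSquareIntegrable.sum h.solid (fun i => h.squareIntegrable (n + i)) j)
      (by rintro rfl; simp)
      (fun k hk => sum_mem_range_of_forall_mem h.martingale.filtration j hk)
    refine ⟨q + (g + g) + z (n + j), ?_, ?_⟩
    · rw [Finset.sum_range_succ, map_add, map_add, map_add, hq, hg, h.square, map_add]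
      ring
    · rw [map_add, map_add, map_add, hTq, hTg, Finset.sum_range_succ]
      simp

/-- In the pathwise bound each increment is multiplied by a maximum of earlier sums only, so `T 0`
annihilates these products and leaves the squares. -/
theorem smul_map_runningMax_le (h : IsSquareMartingaleDifference ι e T X z) (n j : ℕ) (ε : ℝ) :
    ε • T 0 (runningMax (fun i => X (n + i)) j) ≤
      ε ^ 2 • e + ∑ i ∈ Finset.range j, T 0 (z (n + i)) := by
  have hmax : ∀ i, ∃ g, ι g = ι (X (n + i)) * ι (runningMax (fun i => X (n + i)) i) ∧
      T 0 g = 0 := fun i =>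
    h.exists_mul n i (IsSquareIntegrable.runningMax h.completion h.solid
      (fun l => h.squareIntegrable (n + l)) i) (by rintro rfl; rfl)
      (fun k hk => runningMax_mem_range h.martingale.filtration i hk)
  choose g hg hTg using hmax
  obtain ⟨q, hq, hTq⟩ := h.exists_sum_square n j
  have h1 := smul_runningMax_le h.completion (fun i => X (n + i)) j ε
  have h2 : ε • runningMax (fun i => X (n + i)) j + ∑ i ∈ Finset.range j, g i ≤
      ε ^ 2 • e + q := by
    rw [← h.completion.map_le_iff, map_add, map_add, map_sum, map_smul, map_smul, h.map_unit, hq]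
    simpa only [hg] using h1
  have h3 := monotone_of_nonneg (h.martingale.filtration.condExp 0).nonneg h2
  rw [map_add, map_add, map_sum, map_smul, map_smul, h.fixes_unit, hTq] at h3
  simpa only [hTg, Finset.sum_const_zero, add_zero] using h3

/-- An `L²`-bounded martingale is order Cauchy. -/
theorem exists_orderCauchy (h : IsSquareMartingaleDifference ι e T X z) {B : E}
    (hB : ∀ n, ∑ i ∈ Finset.range n, T 0 (z i) ≤ B) :
    ∃ D : ℕ → E, Antitone D ∧ IsGLB (Set.range D) 0 ∧ ∀ n i j, n ≤ i → n ≤ j →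
      |∑ l ∈ Finset.range i, X l - ∑ l ∈ Finset.range j, X l| ≤ D n := by
  have hT0 := h.martingale.filtration.condExp 0
  set P : ℕ → E := fun n => ∑ i ∈ Finset.range n, T 0 (z i) with hP
  obtain ⟨S, hS⟩ : ∃ S, IsLUB (Set.range P) S :=
    ⟨_, isLUB_ciSup ⟨B, by rintro _ ⟨n, rfl⟩; exact hB n⟩⟩
  have htail : ∀ n j, ∑ i ∈ Finset.range j, T 0 (z (n + i)) ≤ S - P n := by
    intro n j
    rw [le_sub_iff_add_le, add_comm, hP]
    dsimp only
    rw [← Finset.sum_range_add]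
    exact hS.1 ⟨n + j, rfl⟩
  -- Using `X` and `-X` together makes `w n j` dominate the absolute value of the increment from `n`
  -- to `n + j`.
  set w : ℕ → ℕ → E := fun n j =>
    runningMax (fun i => X (n + i)) j + runningMax (fun i => (-X) (n + i)) j with hw
  have hw_mono : ∀ n, Monotone (w n) := fun n i j hij =>
    add_le_add (runningMax_mono _ hij) (runningMax_mono _ hij)
  have hw0 : ∀ n j, 0 ≤ w n j := fun n j =>
    add_nonneg (runningMax_nonneg _ _) (runningMax_nonneg _ _)
  have hwT : ∀ n j (ε : ℝ), 0 < ε →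
      T 0 (w n j) ≤ (2 * ε⁻¹) • (ε ^ 2 • e + (S - P n)) := by
    intro n j ε hε
    have h1 := (h.smul_map_runningMax_le n j ε).trans (add_le_add_right (htail n j) _)
    have h2 := (h.neg.smul_map_runningMax_le n j ε).trans (add_le_add_right (htail n j) _)
    have h3 := smul_le_smul_of_nonneg_left (add_le_add h1 h2) (inv_nonneg.2 hε.le)
    rw [← smul_add, ← map_add, smul_smul, inv_mul_cancel₀ hε.ne', one_smul] at h3
    refine h3.trans (le_of_eq ?_)
    module
  have hwB : ∀ n, BddAbove (Set.range (w n)) := fun n =>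
    bddAbove_of_map_le h.completion h.map_unit hT0 h.strictlyPositive h.naturalDomain
      (hw_mono n) (hw0 n) (fun j => hwT n j 1 one_pos)
  have hW : ∀ n, IsLUB (Set.range (w n)) (⨆ j, w n j) := fun n => isLUB_ciSup (hwB n)
  set W : ℕ → E := fun n => ⨆ j, w n j
  have hWT : ∀ n (ε : ℝ), 0 < ε → T 0 (W n) ≤ (2 * ε⁻¹) • (ε ^ 2 • e + (S - P n)) :=
    fun n ε hε => hT0.map_le_of_isLUB (hw_mono n) (hW n) fun j => hwT n j ε hε
  have hW0 : ∀ n, 0 ≤ W n := fun n => (hw0 n 0).trans ((hW n).1 ⟨0, rfl⟩)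
  have hMW : ∀ n i, n ≤ i →
      |∑ l ∈ Finset.range i, X l - ∑ l ∈ Finset.range n, X l| ≤ W n := by
    intro n i hni
    obtain ⟨j, rfl⟩ := Nat.exists_eq_add_of_le hni
    rw [Finset.sum_range_add, add_sub_cancel_left]
    refine le_trans (sup_le ?_ ?_) ((hW n).1 ⟨j, rfl⟩)
    · exact (sum_le_runningMax (fun i => X (n + i)) j).trans
        (le_add_of_nonneg_right (runningMax_nonneg _ _))
    · have := sum_le_runningMax (fun i => (-X) (n + i)) j
      simp only [Pi.neg_apply, Finset.sum_neg_distrib] at this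
      exact this.trans (le_add_of_nonneg_left (runningMax_nonneg _ _))
  have hMWW : ∀ n i j, n ≤ i → n ≤ j →
      |∑ l ∈ Finset.range i, X l - ∑ l ∈ Finset.range j, X l| ≤ W n + W n := by
    intro n i j hi hj
    have h2 := hMW n j hj
    rw [abs_sub_comm] at h2
    have := (abs_add_le _ _).trans (add_le_add (hMW n i hi) h2)
    rwa [sub_add_sub_cancel] at this
  -- Monotonicity of `W` is not available, so `D` is the running infimum of `2 W`.
  refine ⟨fun n => Nat.rec (W 0 + W 0) (fun m d => d ⊓ (W (m + 1) + W (m + 1))) n,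
    antitone_nat_of_succ_le fun n => inf_le_left, ?_, ?_⟩
  · constructor
    · rintro _ ⟨n, rfl⟩
      induction n with
      | zero => exact add_nonneg (hW0 0) (hW0 0)
      | succ n ih => exact le_inf ih (add_nonneg (hW0 _) (hW0 _))
    · intro y hy
      have hyW : ∀ n, y ≤ W n + W n := by
        intro n
        refine (hy ⟨n, rfl⟩).trans ?_
        cases n with
        | zero => exact le_rfl
        | succ n => exact inf_le_right
      have hyW' : ∀ n, y⁺ ≤ W n + W n := fun n => by
        rw [posPart_def]
        exact sup_le (hyW n) (add_nonneg (hW0 n) (hW0 n))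
      have he0 : 0 ≤ e := by
        rw [← h.completion.map_nonneg_iff, h.map_unit]
        exact zero_le_one
      have hTy : T 0 y⁺ ≤ 0 := by
        refine nonpos_of_forall_le_smul (y := (4 : ℝ) • e) (smul_nonneg (by norm_num) he0)
          fun ε hε => ?_
        -- The bound on `T 0 (W n)` counted twice has factor `4 / ε`, hence the scaling by `ε / 4`.
        -- Taking the supremum over `n` removes the tail `S - P n` and leaves `T 0 y⁺ ≤ 4 ε e`.
        have h1 : ∀ n, P n ≤ S - ((ε / 4) • T 0 y⁺ - ε ^ 2 • e) := by
          intro n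
          have h2 := monotone_of_nonneg hT0.nonneg (hyW' n)
          rw [map_add] at h2
          have h3 := smul_le_smul_of_nonneg_left
            (h2.trans (add_le_add (hWT n ε hε) (hWT n ε hε))) (show 0 ≤ ε / 4 by positivity)
          rw [← add_smul, smul_smul, show ε / 4 * (2 * ε⁻¹ + 2 * ε⁻¹) = 1 by field_simp; norm_num,
            one_smul] at h3
          rw [le_sub_comm, sub_le_iff_le_add']
          exact h3
        have h2 : S ≤ S - ((ε / 4) • T 0 y⁺ - ε ^ 2 • e) :=
          hS.2 (by rintro _ ⟨n, rfl⟩; exact h1 n)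
        rw [le_sub_self_iff, sub_nonpos] at h2
        have h3 := smul_le_smul_of_nonneg_left h2 (show 0 ≤ 4 / ε by positivity)
        rw [smul_smul, smul_smul, show 4 / ε * (ε / 4) = 1 by field_simp,
          show 4 / ε * ε ^ 2 = ε * 4 by field_simp, one_smul] at h3
        rwa [smul_smul]
      have hy0 : y⁺ = 0 := h.strictlyPositive _ (by
        rw [abs_of_nonneg (posPart_nonneg y)]
        exact le_antisymm hTy (hT0.nonneg _ (posPart_nonneg y)))
      exact (le_posPart y).trans hy0.le
  · intro n
    induction n with
    | zero => exact fun i j hi hj => hMWW 0 i j hi hj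
    | succ n ih =>
      exact fun i j hi hj => le_inf (ih i j (by omega) (by omega)) (hMWW _ i j hi hj)

end IsSquareMartingaleDifference

end MartingaleConvergence

/-! ### The scalar inequality and the conclusion -/

theorem sq_div_le_rpow_add {p γ k a c : ℝ} (hp : 2 < p) (hc : 0 < c) (hca : c ≤ a)
    (hpγ : γ + (p / 2 - 1) * k ≤ p) {t : ℝ} (ht : 0 ≤ t) :
    1 / a ^ 2 * t ^ 2 ≤ 1 / a ^ γ * t ^ p +
      c ^ (k - (p - γ) / (p / 2 - 1)) * (1 / a ^ k) := by
  have ha : 0 < a := hc.trans_le hca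
  have hp2 : 0 < p - 2 := by linarith
  have hβ : 0 ≤ c ^ (k - (p - γ) / (p / 2 - 1)) * (1 / a ^ k) := by positivity
  have hα : 0 ≤ 1 / a ^ γ * t ^ p := by positivity
  -- At this threshold `t ^ 2 / a ^ 2` and `t ^ p / a ^ γ` coincide. Above it the power dominates;
  -- below it the square term is at most `a ^ (-(p - γ) / (p / 2 - 1))`, which the condition on `p`
  -- compares with `1 / a ^ k`.
  rcases le_total (a ^ ((γ - 2) / (p - 2))) t with h | h
  · refine le_add_of_le_of_nonneg ?_ hβ
    have ht0 : 0 < t := (Real.rpow_pos_of_pos ha _).trans_le h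
    have h1 := Real.rpow_le_rpow (by positivity) h hp2.le
    rw [← Real.rpow_mul ha.le, div_mul_cancel₀ _ hp2.ne'] at h1
    have e1 : a ^ γ = a ^ (γ - 2) * a ^ 2 := by
      rw [← Real.rpow_natCast, ← Real.rpow_add ha]; norm_num
    have e2 : t ^ p = t ^ (p - 2) * t ^ 2 := by
      rw [← Real.rpow_natCast, ← Real.rpow_add ht0]; norm_num
    have hg : 0 < a ^ (γ - 2) := Real.rpow_pos_of_pos ha _
    rw [e1, e2, one_div_mul_eq_div, one_div_mul_eq_div, div_le_div_iff₀ (by positivity)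
      (by positivity)]
    have := mul_le_mul_of_nonneg_right h1 (show 0 ≤ t ^ 2 * a ^ 2 by positivity)
    linarith
  · refine le_add_of_nonneg_of_le hα ?_
    have hd : k - (p - γ) / (p / 2 - 1) ≤ 0 := by
      rw [sub_nonpos, le_div_iff₀ (by linarith)]; linarith
    have h1 : t ^ 2 ≤ (a ^ ((γ - 2) / (p - 2))) ^ 2 := by gcongr
    have h2 : 1 / a ^ 2 * (a ^ ((γ - 2) / (p - 2))) ^ 2 =
        a ^ (k - (p - γ) / (p / 2 - 1)) * (1 / a ^ k) := by
      rw [one_div, one_div, ← Real.rpow_natCast, ← Real.rpow_natCast, ← Real.rpow_neg ha.le,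
        ← Real.rpow_mul ha.le, ← Real.rpow_add ha, ← Real.rpow_neg ha.le, ← Real.rpow_add ha]
      congr 1
      push_cast
      have : p / 2 - 1 ≠ 0 := by linarith
      field_simp
      ring
    have h3 : a ^ (k - (p - γ) / (p / 2 - 1)) ≤ c ^ (k - (p - γ) / (p / 2 - 1)) :=
      Real.rpow_le_rpow_of_nonpos hc hca hd
    calc 1 / a ^ 2 * t ^ 2 ≤ 1 / a ^ 2 * (a ^ ((γ - 2) / (p - 2))) ^ 2 := by gcongr
      _ = a ^ (k - (p - γ) / (p / 2 - 1)) * (1 / a ^ k) := h2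
      _ ≤ _ := by gcongr

theorem tendsto_atTop_of_summable_rpow {a : ℕ → ℝ} {k : ℝ} (ha_pos : ∀ i, 0 < a i)
    (ha_mono : Monotone a) (h : Summable fun i => 1 / a i ^ k) :
    Filter.Tendsto a Filter.atTop Filter.atTop := by
  rcases tendsto_atTop_of_monotone ha_mono with h1 | ⟨l, hl⟩
  · exact h1
  · have hl0 : 0 < l := (ha_pos 0).trans_le (ha_mono.ge_of_tendsto hl 0)
    have h2 := (tendsto_const_nhds (x := (1 : ℝ))).div
      (hl.rpow_const (p := k) (Or.inl hl0.ne')) (Real.rpow_pos_of_pos hl0 k).ne'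
    have h3 := tendsto_nhds_unique h.tendsto_atTop_zero h2
    have : 0 < 1 / l ^ k := by positivity
    exact absurd h3 this.ne

theorem corollary6p2
    {E U : Type*}
    [AddCommGroup E] [ConditionallyCompleteLattice E] [IsOrderedAddMonoid E]
    [Module ℝ E] [IsOrderedModule ℝ E]
    [CommRing U] [ConditionallyCompleteLattice U] [IsOrderedRing U]
    [Algebra ℝ U] [IsOrderedModule ℝ U] [IsFAlgebra U]
    (ι : E →ₗ[ℝ] U) (hι : IsUniversalCompletion ι)
    (e : E) (he : ι e = 1)
    (T : ℕ → E →ₗ[ℝ] E)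
    (hT_pos : StrictlyPositiveOperator (T 0))
    (hT_unit : T 0 e = e)
    (hT_dom : IsNaturalDomain ι (T 0))
    (p γ k : ℝ) (hp : 2 < p)
    (Y : ℕ → E) (hY : IsMartingaleDifference Y T)
    (hYp : ∀ i, Y i ∈ rieszLp ι p)
    (a : ℕ → ℝ) (ha_pos : ∀ i, 0 < a i) (ha_mono : Monotone a)
    (ha_sum : Summable fun i => 1 / a i ^ k)
    (hsum : OrderSummable fun i => T 0 ((1 / a i ^ γ) • absPow ι p (Y i)))
    (hpγ : γ + (p / 2 - 1) * k ≤ p) :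
    OrderTendsto (fun n => (1 / a n) • ∑ i ∈ Finset.range (n + 1), Y i) 0 := by
  have hT0 := hY.filtration.condExp 0
  have he0 : 0 ≤ e := by
    rw [← hι.map_nonneg_iff, he]
    exact zero_le_one
  have hpow : ∀ i, ι (absPow ι p (Y i)) = rieszPow |ι (Y i)| p := fun i =>
    Function.invFun_eq (hYp i)
  -- The exponent is nonpositive and `a 0` is the least weight, so this one constant serves every
  -- index.
  set c := a 0 ^ (k - (p - γ) / (p / 2 - 1)) with hc
  have hc0 : 0 ≤ c := Real.rpow_nonneg (ha_pos 0).le _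
  have hsq : ∀ i, ι ((1 / a i) • Y i) * ι ((1 / a i) • Y i) ≤
      ι ((1 / a i ^ γ) • absPow ι p (Y i) + (c * (1 / a i ^ k)) • e) := by
    intro i
    have hai := ha_pos i
    have h1 := smul_mul_self_le_rieszPow (abs_nonneg (ι (Y i))) (p := p) (by linarith)
      (α := 1 / a i ^ 2) (β := c * (1 / a i ^ k)) (c := 1 / a i ^ γ) (by positivity)
      (by positivity) (by positivity)
      (fun t ht => sq_div_le_rpow_add hp (ha_pos 0) (ha_mono i.zero_le) hpγ ht)
    rw [abs_mul_abs_eq] at h1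
    rw [map_add, map_smul, map_smul, map_smul, hpow, he, smul_mul_smul_comm]
    convert h1 using 2
    field_simp
  have hsolid : IsSolidRange ι := fun _ _ h0 h1 => mem_range_of_le hι hT0.nonneg hT_dom h0 h1
  choose z hz using fun i => IsSquareIntegrable.of_le hsolid (hsq i)
  have hX : IsSquareMartingaleDifference ι e T (fun i => (1 / a i) • Y i) z :=
    { completion := hι
      map_unit := he
      strictlyPositive := hT_pos
      fixes_unit := hT_unit
      naturalDomain := hT_dom
      martingale :=
        { filtration := hY.filtration
          adapted := fun i => by
            obtain ⟨y, hy⟩ := hY.adapted i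
            exact ⟨(1 / a i) • y, by rw [map_smul, hy]⟩
          diff := fun i => by rw [map_smul, hY.diff, smul_zero] }
      square := hz }
  obtain ⟨s, v, hv, -, hsv⟩ := hsum
  have hB : ∀ n, ∑ i ∈ Finset.range n, T 0 (z i) ≤ s + v 0 + (c * ∑' i, 1 / a i ^ k) • e := by
    intro n
    have h1 : ∀ i, T 0 (z i) ≤
        T 0 ((1 / a i ^ γ) • absPow ι p (Y i)) + (c * (1 / a i ^ k)) • e := by
      intro i
      have h2 := hsq i
      rw [← hz, hι.map_le_iff] at h2
      have h3 := monotone_of_nonneg hT0.nonneg h2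
      rwa [map_add, map_smul (T 0) (c * _), hT_unit] at h3
    refine (Finset.sum_le_sum fun i _ => h1 i).trans ?_
    rw [Finset.sum_add_distrib, ← Finset.sum_smul, ← Finset.mul_sum]
    refine add_le_add ?_ (smul_le_smul_of_nonneg_right (mul_le_mul_of_nonneg_left
      (ha_sum.sum_le_tsum _ fun i _ => ?_) hc0) he0)
    -- Order convergence enters through a uniform bound: the partial sums differ from `s` by at most
    -- `v n ≤ v 0`.
    · rw [← sub_le_iff_le_add']
      exact (le_abs_self _).trans ((hsv n).trans (hv n.zero_le))
    · have := ha_pos i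
      positivity
  obtain ⟨D, hD, hD0, hMD⟩ := hX.exists_orderCauchy hB
  exact orderTendsto_zero_of_orderCauchy ha_pos ha_mono
    (tendsto_atTop_of_summable_rpow ha_pos ha_mono ha_sum) hD hD0 hMD
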